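/- Let $d\ge 1$, $1\le p<\infty$, $d/p<s\le 1$, $\alpha=s-d/p$, and let $K\subseteq\mathbb{R}^d$ be an open set with Lipschitz boundary (locally, up to a rigid motion, $K$ is the region above the graph of a Lipschitz function). For $g:K\to\mathbb{R}$ put $|g|_{C^{0,\alpha}(K)}:=\sup_{x\ne y\in K}|g(x)-g(y)|/|x-y|^{\alpha}$ and $$|g|_{W^{s,p}(K)}:=\left(\int_K\int_K\frac{|g(x)-g(y)|^p}{|x-y|^{d+sp}}\,dx\,dy\right)^{1/p}\ \text{ if } s<1,\qquad |g|_{W^{1,p}(K)}:=\|\nabla g\|_{L^p(K)}\ \text{ (weak gradient; } \infty \text{ if there is none)}.$$ Let $C_{s,d,p}(K)\in[0,\infty]$ be the best constant $C$ such that every locally integrable $g$ on $K$ with $|g|_{W^{s,p}(K)}<\infty$ has a representative $h$ with $|h|_{C^{0,\alpha}(K)}\le C\,|g|_{W^{s,p}(K)}$. (a) If $K$ is bounded or $K=\mathbb{R}^d$, and if moreover $K$ is connected in the case $s=1$, then $C_{s,d,p}(K)<\infty$. (b) Assume $C_{s,d,p}(K)<\infty$. Let $K\subseteq\mathbb{X}\subseteq\mathbb{R}^d$,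 with the Euclidean distance and the Borel $\sigma$-algebra on $\mathbb{X}$, let $\Theta$ be a Polish space with its Borel $\sigma$-algebra, $\pi$ a probability measure on $\Theta$, $\lambda$ a $\sigma$-finite measure on $\mathbb{X}$, and $\nu(\cdot\,|\,\theta)$ a probability kernel from $\Theta$ to $\mathbb{X}$ with densities $f(\cdot\,|\,\theta)\ge 0$ with respect to $\lambda$, where $f$ is jointly measurable and $f(\cdot\,|\,\theta)$ is continuous on $K$ for $\pi$-almost every $\theta$. Put $\rho(x):=\int_\Theta f(x\,|\,\theta)\,\pi(d\theta)\in[0,\infty]$ and suppose that $\rho$ is not identically $+\infty$ on $K$, that $$B:=\int_\Theta|f(\cdot\,|\,\theta)|_{W^{s,p}(K)}\,\pi(d\theta)<\infty\qquad\text{and}\qquad R(K):=\inf_K\rho>0 .$$ Then $\rho<\infty$ on $K$, and the posterior distributions $\pi(A\,|\,x)=\rho(x)^{-1}\int_A f(x\,|\,\theta)\,\pi(d\theta)$ satisfy $$\sup_{A\subseteq\Theta\text{ Borel}}\bigl|\pi(A\,|\,x)-\pi(A\,|\,y)\bigr|\le\frac{C_{s,d,p}(K)\,B}{R(K)}\,|x-y|^{\alpha}\qquad\text{for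 all }x,y\in K .$$ -/

import Mathlib

open MeasureTheory ProbabilityTheory
open scoped ENNReal

noncomputable section

/-- `K ⊆ ℝ^d` has Lipschitz boundary: near each boundary point `x₀`, for a suitable unit vector `e`,
the set `K` is the region strictly above, in direction `e`, the graph of a Lipschitz function `φ` of
the component `x - ⟪e, x⟫ e` of `x` orthogonal to `e`. -/
def HasLipschitzBoundary {d : ℕ} (K : Set (EuclideanSpace ℝ (Fin d))) : Prop :=
  ∀ x₀ ∈ frontier K, ∃ e : EuclideanSpace ℝ (Fin d), ‖e‖ = 1 ∧
    ∃ (L : NNReal) (φ : EuclideanSpace ℝ (Fin d) → ℝ), LipschitzWith L φ ∧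
      ∃ r > 0, ∀ x ∈ Metric.ball x₀ r, x ∈ K ↔ φ (x - inner ℝ e x • e) < inner ℝ e x

/-- The Hölder seminorm `|g|_{C^{0,α}(K)}`, with values in `[0, ∞]`. -/
def holderSeminorm {d : ℕ} (α : ℝ) (K : Set (EuclideanSpace ℝ (Fin d)))
    (g : EuclideanSpace ℝ (Fin d) → ℝ) : ℝ≥0∞ :=
  ⨆ x ∈ K, ⨆ y ∈ K, ⨆ (_ : x ≠ y), ‖g y - g x‖ₑ / edist x y ^ α

/-- The Gagliardo seminorm of `g` on `K`, with values in `[0, ∞]`. -/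
def gagliardoSeminorm {d : ℕ} (s p : ℝ) (K : Set (EuclideanSpace ℝ (Fin d)))
    (g : EuclideanSpace ℝ (Fin d) → ℝ) : ℝ≥0∞ :=
  (∫⁻ x in K, ∫⁻ y in K, ‖g x - g y‖ₑ ^ p / edist x y ^ ((d : ℝ) + s * p)) ^ (1 / p)

/-- `G` is a weak (distributional) gradient of `g` on the open set `K`. -/
def IsWeakGradient {d : ℕ} (K : Set (EuclideanSpace ℝ (Fin d)))
    (g : EuclideanSpace ℝ (Fin d) → ℝ)
    (G : EuclideanSpace ℝ (Fin d) → EuclideanSpace ℝ (Fin d)) : Prop :=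
  LocallyIntegrableOn G K ∧
    ∀ φ : EuclideanSpace ℝ (Fin d) → ℝ, ContDiff ℝ ((⊤ : ℕ∞) : WithTop ℕ∞) φ →
      HasCompactSupport φ → tsupport φ ⊆ K →
      ∀ v : EuclideanSpace ℝ (Fin d),
        ∫ x in K, g x * fderiv ℝ φ x v = - ∫ x in K, φ x * inner ℝ (G x) v

/-- `‖∇g‖_{L^p(K)}`, which is `∞` if `g` has no weak gradient on `K`.
(Weak gradients are unique almost everywhere, so that the infimum is over a single value.) -/
def gradientSeminorm {d : ℕ} (p : ℝ) (K : Set (EuclideanSpace ℝ (Fin d)))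
    (g : EuclideanSpace ℝ (Fin d) → ℝ) : ℝ≥0∞ :=
  ⨅ (G : EuclideanSpace ℝ (Fin d) → EuclideanSpace ℝ (Fin d)) (_ : IsWeakGradient K g G),
    eLpNorm G (ENNReal.ofReal p) (volume.restrict K)

open scoped Classical in
/-- The seminorm `|g|_{W^{s,p}(K)}` for `0 < s ≤ 1`: the `L^p` norm of the gradient if `s = 1`, the
Gagliardo seminorm if `s < 1`. -/
def sobolevSeminorm {d : ℕ} (s p : ℝ) (K : Set (EuclideanSpace ℝ (Fin d)))
    (g : EuclideanSpace ℝ (Fin d) → ℝ) : ℝ≥0∞ :=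
  if s = 1 then gradientSeminorm p K g else gagliardoSeminorm s p K g

/-- The Sobolev inequality on `K` with constant `C`: every locally integrable `g` with finite
`W^{s,p}(K)` seminorm has a representative `h` with
`|h|_{C^{0,s-d/p}(K)} ≤ C |g|_{W^{s,p}(K)}`. -/
def SobolevInequality {d : ℕ} (s p : ℝ) (K : Set (EuclideanSpace ℝ (Fin d))) (C : ℝ≥0∞) : Prop :=
  ∀ g : EuclideanSpace ℝ (Fin d) → ℝ, LocallyIntegrableOn g K → sobolevSeminorm s p K g ≠ ∞ →
    ∃ h : EuclideanSpace ℝ (Fin d) → ℝ, h =ᵐ[volume.restrict K] g ∧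
      holderSeminorm (s - d / p) K h ≤ C * sobolevSeminorm s p K g

/-- `C_{s,d,p}(K) ∈ [0, ∞]`, the best constant in the Sobolev inequality on `K`. -/
def sobolevConstant {d : ℕ} (s p : ℝ) (K : Set (EuclideanSpace ℝ (Fin d))) : ℝ≥0∞ :=
  sInf {C : ℝ≥0∞ | SobolevInequality s p K C}

/-- The total variation distance `sup_B |μ₁ B - μ₂ B|` of two finite measures. -/
def tvDistance {Θ : Type*} [MeasurableSpace Θ] (μ₁ μ₂ : Measure Θ) : ℝ≥0∞ :=
  ⨆ (B : Set Θ) (_ : MeasurableSet B), ENNReal.ofReal |μ₁.real B - μ₂.real B|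

/-- `ρ(x) = ∫ f(x|θ) π(dθ)`, with values in `[0, ∞]`. -/
def marginalDensity {X Θ : Type*} [MeasurableSpace Θ] (π : Measure Θ) (f : X → Θ → ℝ) (x : X) :
    ℝ≥0∞ :=
  ∫⁻ θ, ENNReal.ofReal (f x θ) ∂π

/-- The posterior distribution `π(B|x) = ρ(x)⁻¹ ∫_B f(x|θ) π(dθ)`, a probability measure
if `0 < ρ(x) < ∞`. -/
def bayesPosterior {X Θ : Type*} [MeasurableSpace Θ] (π : Measure Θ) (f : X → Θ → ℝ) (x : X) :
    Measure Θ :=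
  (marginalDensity π f x)⁻¹ • π.withDensity (fun θ => ENNReal.ofReal (f x θ))

/-- `R(K) = inf_K ρ`, for `K` a set of points of the ambient space of `X`. -/
def infMarginal {E Θ : Type*} [MeasurableSpace Θ] {X : Set E} (π : Measure Θ) (f : X → Θ → ℝ)
    (K : Set E) : ℝ≥0∞ :=
  ⨅ (x : X) (_ : (x : E) ∈ K), marginalDensity π f x

/-- `∫ |f(·|θ)|_{W^{s,p}(K)} π(dθ)`, where `K ⊆ X` (the values of the extension of `f(·|θ)` outside
`X` play no role). -/
def sobolevAverage {d : ℕ} {Θ : Type*} [MeasurableSpace Θ] {X : Set (EuclideanSpace ℝ (Fin d))}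
    (s p : ℝ) (K : Set (EuclideanSpace ℝ (Fin d))) (π : Measure Θ) (f : X → Θ → ℝ) : ℝ≥0∞ :=
  ∫⁻ θ, sobolevSeminorm s p K (Function.extend Subtype.val (fun x : X => f x θ) 0) ∂π

end

/-!
**The Sobolev inequality.** Both seminorms bound the oscillation of `g` over compact convex sets
`A ⊆ K` of radius `r`,
`∫_A ∫_A |g x - g y| ^ p ≤ M * r ^ (d + s * p) * |g|_{W^{s,p}(K)} ^ p`
(`exists_hasOscillationBound`): trivially if `s < 1`, and by Poincaré's inequality on convex sets if
`s = 1`, where one integrates the derivative along segments and passes to weak gradients by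
mollification (`IsWeakGradient.lintegral_lintegral_rpow_enorm_sub_le`). Everything else uses this
bound only. If `A` has comparable inner and outer radii, it shows that the averages of `g` over the
contractions of `A` towards a point `x ∈ A` by the factors `2⁻ᵏ` differ by at most a constant times
`(2⁻ᵏ * r) ^ (s - d / p) * |g|_{W^{s,p}(K)}`. As the averages converge to `g x` at Lebesgue points,
summing a geometric series gives `|g x - g y| ≤ C * r ^ (s - d / p) * |g|_{W^{s,p}(K)}` for Lebesgue
points `x, y ∈ A` (`exists_edist_isLebesguePoint_le`). With balls as `A`, this yields a continuous
representative, and the Hölder estimate for pairs of points at distance less than that to the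
complement of `K`. Near a boundary point, each of the points `x` and `y` is instead joined to a
common third one inside a truncated cone of size comparable to `|x - y|`, which is contained in the
region above a Lipschitz graph if its apex is (`HasLipschitzBoundary.exists_truncatedCone`).

To go from local to global estimates, let `oscillationDistance s p K x y` be the largest value of
`|h x - h y|` for continuous `h` of seminorm one. This satisfies the triangle inequality, is locally
bounded by a multiple of `|x - y| ^ (s - d / p)` near each point of the closure of `K`, and is
finite on `K`: by connectedness if `s = 1`, and because the Gagliardo seminorm compares any two balls if
`s < 1`. By compactness, it is globally bounded by such a multiple (`exists_le_mul_edist_rpow`).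

**The posterior.** Almost every density is continuous on `K`, so that it is its own Hölder
representative, and integration over `θ` gives
`∫ |f x θ - f y θ| π(dθ) ≤ C_{s,d,p}(K) * B * |x - y| ^ (s - d / p)` (`lintegral_edist_le`).
The left-hand side divided by `ρ x` bounds the total variation distance of the posteriors, including
the effect of their normalization (`tvDistance_bayesPosterior_le`).
-/

open Filter Topology Metric Set

/-! ### Poincaré's inequality on convex sets -/

/-- Jensen's inequality for `t ↦ t ^ p` and a finite measure that need not be normalized. -/
theorem rpow_lintegral_le {α : Type*} [MeasurableSpace α] {μ : Measure α} {f : α → ℝ≥0∞}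
    (hf : AEMeasurable f μ) {p : ℝ} (hp : 1 ≤ p) :
    (∫⁻ a, f a ∂μ) ^ p ≤ μ univ ^ (p - 1) * ∫⁻ a, f a ^ p ∂μ := by
  have hp0 : 0 < p := by linarith
  have h := eLpNorm'_le_eLpNorm'_mul_rpow_measure_univ (μ := μ) (f := f) (p := 1) (q := p)
    one_pos hp hf.aestronglyMeasurable
  simp only [eLpNorm', enorm_eq_self, ENNReal.rpow_one, div_one] at h
  calc (∫⁻ a, f a ∂μ) ^ p
      ≤ ((∫⁻ a, f a ^ p ∂μ) ^ (1 / p) * μ univ ^ (1 - 1 / p)) ^ p :=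
        ENNReal.rpow_le_rpow h hp0.le
    _ = μ univ ^ (p - 1) * ∫⁻ a, f a ^ p ∂μ := by
        rw [ENNReal.mul_rpow_of_nonneg _ _ hp0.le, ← ENNReal.rpow_mul, ← ENNReal.rpow_mul,
          one_div_mul_cancel hp0.ne', ENNReal.rpow_one, mul_comm]
        congr 2
        field_simp

theorem rpow_enorm_sub_le_lintegral_segment {E : Type*} [NormedAddCommGroup E]
    [NormedSpace ℝ E] {u : E → ℝ} (hu : ContDiff ℝ 1 u) {p : ℝ} (hp : 1 ≤ p)
    (x y : E) :
    ‖u x - u y‖ₑ ^ p ≤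
      ‖x - y‖ₑ ^ p * ∫⁻ t in Icc (0 : ℝ) 1, ‖fderiv ℝ u (y + t • (x - y))‖ₑ ^ p := by
  have hp0 : 0 < p := by linarith
  have hcont : Continuous fun t : ℝ => fderiv ℝ u (y + t • (x - y)) :=
    (hu.continuous_fderiv one_ne_zero).comp (by fun_prop)
  have hderiv : ∀ t ∈ uIcc (0 : ℝ) 1, HasDerivAt (fun t : ℝ => u (y + t • (x - y)))
      (fderiv ℝ u (y + t • (x - y)) (x - y)) t := by
    intro t _
    have h1 : HasDerivAt (fun t : ℝ => y + t • (x - y)) (x - y) t := by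
      simpa using ((hasDerivAt_id t).smul_const (x - y)).const_add y
    exact ((hu.differentiable one_ne_zero _).hasFDerivAt).comp_hasDerivAt t h1
  have hftc := intervalIntegral.integral_eq_sub_of_hasDerivAt hderiv
    ((hcont.clm_apply continuous_const).intervalIntegrable _ _)
  simp only [one_smul, add_sub_cancel, zero_smul, add_zero] at hftc
  rw [← hftc, intervalIntegral.integral_of_le zero_le_one, ← integral_Icc_eq_integral_Ioc]
  calc ‖∫ t in Icc (0 : ℝ) 1, fderiv ℝ u (y + t • (x - y)) (x - y)‖ₑ ^ p
      ≤ (∫⁻ t in Icc (0 : ℝ) 1, ‖fderiv ℝ u (y + t • (x - y))‖ₑ * ‖x - y‖ₑ) ^ p := by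
        gcongr
        refine (enorm_integral_le_lintegral_enorm _).trans (lintegral_mono fun t => ?_)
        exact ContinuousLinearMap.le_opENorm _ _
    _ = ‖x - y‖ₑ ^ p * (∫⁻ t in Icc (0 : ℝ) 1, ‖fderiv ℝ u (y + t • (x - y))‖ₑ) ^ p := by
        rw [lintegral_mul_const' _ _ enorm_ne_top, ENNReal.mul_rpow_of_nonneg _ _ hp0.le, mul_comm]
    _ ≤ _ := by
        gcongr
        refine (rpow_lintegral_le hcont.enorm.measurable.aemeasurable hp).trans ?_
        simp

theorem lintegral_lintegral_const_mul_lintegral {α β γ : Type*} [MeasurableSpace α]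
    [MeasurableSpace β] [MeasurableSpace γ] {μ : Measure α} {ν : Measure β} {τ : Measure γ}
    [SFinite μ] [SFinite ν] [SFinite τ] (c : ℝ≥0∞) {F : α → β → γ → ℝ≥0∞}
    (hF : Measurable fun q : α × β × γ => F q.1 q.2.1 q.2.2) :
    ∫⁻ x, ∫⁻ y, c * (∫⁻ t, F x y t ∂τ) ∂ν ∂μ = c * ∫⁻ t, ∫⁻ x, ∫⁻ y, F x y t ∂ν ∂μ ∂τ := by
  have h1 : Measurable fun q : (α × β) × γ => F q.1.1 q.1.2 q.2 :=
    hF.comp (by fun_prop : Measurable fun q : (α × β) × γ => (q.1.1, q.1.2, q.2))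
  have h2 : Measurable fun q : (α × γ) × β => F q.1.1 q.2 q.1.2 :=
    hF.comp (by fun_prop : Measurable fun q : (α × γ) × β => (q.1.1, q.2, q.1.2))
  have h3 : Measurable fun q : α × β => ∫⁻ t, F q.1 q.2 t ∂τ := h1.lintegral_prod_right'
  have h4 : Measurable fun q : α × γ => ∫⁻ y, F q.1 y q.2 ∂ν := h2.lintegral_prod_right'
  have h5 : ∀ x, ∫⁻ y, c * (∫⁻ t, F x y t ∂τ) ∂ν = c * ∫⁻ t, ∫⁻ y, F x y t ∂ν ∂τ := by
    intro x
    have h6 : Measurable fun y => ∫⁻ t, F x y t ∂τ := h3.comp measurable_prodMk_left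
    rw [lintegral_const_mul _ h6, lintegral_lintegral_swap]
    exact (hF.comp measurable_prodMk_left).aemeasurable
  simp_rw [h5]
  rw [lintegral_const_mul _ h4.lintegral_prod_right', lintegral_lintegral_swap h4.aemeasurable]

section Poincare

variable {E : Type*} [NormedAddCommGroup E] [NormedSpace ℝ E] [FiniteDimensional ℝ E]
  [MeasurableSpace E] [BorelSpace E] {μ : Measure E} [μ.IsAddHaarMeasure]

theorem lintegral_comp_add_smul {F : E → ℝ≥0∞} (hF : Measurable F) (b : E) {t : ℝ} (ht : t ≠ 0) :
    ∫⁻ x, F (b + t • x) ∂μ = ENNReal.ofReal |(t ^ Module.finrank ℝ E)⁻¹| * ∫⁻ x, F x ∂μ := by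
  have h1 : ∫⁻ x, F (b + t • x) ∂μ = ∫⁻ x, F (b + x) ∂(Measure.map (t • ·) μ) := by
    rw [lintegral_map (f := fun x => F (b + x)) (hF.comp (measurable_const_add b))
      (measurable_const_smul t)]
  rw [h1, Measure.map_addHaar_smul μ ht, lintegral_smul_measure, lintegral_add_left_eq_self]
  rfl

/-- Contracting a convex set towards one of its points, by a factor of at least `1 / 2`, increases
integrals over it by a factor of at most `2 ^ dim`. -/
theorem setLIntegral_comp_contraction_le {F : E → ℝ≥0∞} (hF : Measurable F) {A : Set E}
    (hA : MeasurableSet A) (hAc : Convex ℝ A) {y : E} (hy : y ∈ A) {t : ℝ} (ht : 1 / 2 ≤ t)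
    (ht1 : t ≤ 1) :
    ∫⁻ x in A, F (y + t • (x - y)) ∂μ ≤ 2 ^ Module.finrank ℝ E * ∫⁻ x in A, F x ∂μ := by
  have ht0 : 0 < t := by linarith
  calc ∫⁻ x in A, F (y + t • (x - y)) ∂μ
      = ∫⁻ x, A.indicator (fun x => F (y + t • (x - y))) x ∂μ := (lintegral_indicator hA _).symm
    _ ≤ ∫⁻ x, A.indicator F ((1 - t) • y + t • x) ∂μ := by
        refine lintegral_mono fun x => ?_
        by_cases hx : x ∈ A
        · have h : (1 - t) • y + t • x ∈ A := hAc hy hx (by linarith) ht0.le (by ring)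
          have h2 : y + t • (x - y) = (1 - t) • y + t • x := by module
          simp [hx, h, h2]
        · simp [hx]
    _ = ENNReal.ofReal |(t ^ Module.finrank ℝ E)⁻¹| * ∫⁻ x in A, F x ∂μ := by
        rw [lintegral_comp_add_smul (hF.indicator hA) _ ht0.ne', lintegral_indicator hA]
    _ ≤ _ := by
        gcongr
        rw [abs_of_nonneg (by positivity), ← inv_pow, ENNReal.ofReal_pow (by positivity)]
        gcongr
        rw [show (2 : ℝ≥0∞) = ENNReal.ofReal 2 by simp]
        apply ENNReal.ofReal_le_ofReal
        rw [inv_le_comm₀ ht0 two_pos]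
        linarith

/-- Poincaré's inequality on a convex set, in the form of a bound for the mean oscillation. -/
theorem lintegral_lintegral_rpow_enorm_sub_le {u : E → ℝ} (hu : ContDiff ℝ 1 u) {p : ℝ}
    (hp : 1 ≤ p) {A : Set E} (hA : MeasurableSet A) (hAc : Convex ℝ A) (hAf : μ A ≠ ∞) {D : ℝ≥0∞}
    (hD : ∀ x ∈ A, ∀ y ∈ A, ‖x - y‖ₑ ≤ D) :
    ∫⁻ x in A, ∫⁻ y in A, ‖u x - u y‖ₑ ^ p ∂μ ∂μ ≤
      D ^ p * 2 ^ Module.finrank ℝ E * μ A * ∫⁻ x in A, ‖fderiv ℝ u x‖ₑ ^ p ∂μ := by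
  have hp0 : 0 < p := by linarith
  set F : E → ℝ≥0∞ := fun x => ‖fderiv ℝ u x‖ₑ ^ p with hFdef
  have hFc : Continuous F :=
    ENNReal.continuous_rpow_const.comp (hu.continuous_fderiv one_ne_zero).enorm
  have hF : Measurable F := hFc.measurable
  have : IsFiniteMeasure (μ.restrict A) := ⟨by simpa using hAf.lt_top⟩
  have hslice : ∀ t ∈ Icc (0 : ℝ) 1, ∫⁻ x in A, ∫⁻ y in A, F (y + t • (x - y)) ∂μ ∂μ ≤
      2 ^ Module.finrank ℝ E * μ A * ∫⁻ x in A, F x ∂μ := by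
    -- the contraction is by a factor of at least one half towards `x` or towards `y`
    have hconst : ∫⁻ _ in A, 2 ^ Module.finrank ℝ E * ∫⁻ x in A, F x ∂μ ∂μ =
        2 ^ Module.finrank ℝ E * μ A * ∫⁻ x in A, F x ∂μ := by
      rw [setLIntegral_const]; ring
    intro t ht
    rcases le_total (1 / 2) t with h | h
    · rw [lintegral_lintegral_swap, ← hconst]
      · exact setLIntegral_mono measurable_const fun y hy =>
          setLIntegral_comp_contraction_le hF hA hAc hy h ht.2
      · exact (hFc.comp (by fun_prop)).measurable.aemeasurable
    · rw [← hconst]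
      refine setLIntegral_mono measurable_const fun x hx => ?_
      have := setLIntegral_comp_contraction_le (μ := μ) hF hA hAc hx (t := 1 - t) (by linarith)
        (by linarith [ht.1])
      refine le_trans (le_of_eq (lintegral_congr fun y => ?_)) this
      congr 1
      module
  calc ∫⁻ x in A, ∫⁻ y in A, ‖u x - u y‖ₑ ^ p ∂μ ∂μ
      ≤ ∫⁻ x in A, ∫⁻ y in A, D ^ p *
          (∫⁻ t in Icc (0 : ℝ) 1, F (y + t • (x - y))) ∂μ ∂μ := by
        refine setLIntegral_mono' hA fun x hx => setLIntegral_mono' hA fun y hy => ?_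
        refine (rpow_enorm_sub_le_lintegral_segment hu hp x y).trans ?_
        gcongr
        exact hD x hx y hy
    _ = D ^ p * ∫⁻ t in Icc (0 : ℝ) 1, ∫⁻ x in A, ∫⁻ y in A, F (y + t • (x - y)) ∂μ ∂μ := by
        have hm : Measurable fun q : E × E × ℝ => F (q.2.1 + q.2.2 • (q.1 - q.2.1)) :=
          (hFc.comp (by fun_prop)).measurable
        exact lintegral_lintegral_const_mul_lintegral _ hm
    _ ≤ D ^ p * ∫⁻ t in Icc (0 : ℝ) 1, 2 ^ Module.finrank ℝ E * μ A * ∫⁻ x in A, F x ∂μ := by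
        gcongr D ^ p * ?_
        exact setLIntegral_mono measurable_const hslice
    _ = _ := by
        rw [setLIntegral_const]
        simp
        ring

end Poincare

/-! ### Poincaré's inequality for weak gradients -/

section WeakGradient

variable {d : ℕ} {K : Set (EuclideanSpace ℝ (Fin d))} {g : EuclideanSpace ℝ (Fin d) → ℝ}
  {G : EuclideanSpace ℝ (Fin d) → EuclideanSpace ℝ (Fin d)}

theorem lintegral_enorm_normed {E : Type*} [NormedAddCommGroup E] [NormedSpace ℝ E]
    [FiniteDimensional ℝ E] [MeasurableSpace E] [BorelSpace E] (μ : Measure E) [μ.IsAddHaarMeasure]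
    (φ : ContDiffBump (0 : E)) : ∫⁻ x, ‖φ.normed μ x‖ₑ ∂μ = 1 := by
  simp_rw [Real.enorm_of_nonneg (φ.nonneg_normed _)]
  rw [← ofReal_integral_eq_lintegral_ofReal φ.integrable_normed
    (ae_of_all _ φ.nonneg_normed), φ.integral_normed, ENNReal.ofReal_one]

/-- The gradient of a mollification is the mollification of the weak gradient. -/
theorem enorm_fderiv_convolution_le {B : Set (EuclideanSpace ℝ (Fin d))} (hB : IsCompact B)
    (hBK : B ⊆ K) (hK : MeasurableSet K) (hg : LocallyIntegrableOn g K)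
    (hG : IsWeakGradient K g G) (φ : ContDiffBump (0 : EuclideanSpace ℝ (Fin d)))
    {x : EuclideanSpace ℝ (Fin d)} (hx : closedBall x φ.rOut ⊆ B) :
    ‖fderiv ℝ (convolution (φ.normed volume) (B.indicator g) (ContinuousLinearMap.lsmul ℝ ℝ)
        volume) x‖ₑ ≤ ∫⁻ y in K, ‖φ.normed volume (x - y)‖ₑ * ‖G y‖ₑ := by
  set η := φ.normed (volume : Measure (EuclideanSpace ℝ (Fin d))) with hη
  have hηs : ContDiff ℝ ((⊤ : ℕ∞) : WithTop ℕ∞) η := φ.contDiff_normed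
  have hη1 : ContDiff ℝ 1 η := φ.contDiff_normed (n := 1)
  have hgB : Integrable (B.indicator g) :=
    (integrable_indicator_iff hB.measurableSet).2 (hg.integrableOn_compact_subset hBK hB)
  have hD := φ.hasCompactSupport_normed.hasFDerivAt_convolution_left
    (ContinuousLinearMap.lsmul ℝ ℝ) hη1 hgB.locallyIntegrable x
  rw [hD.fderiv]
  have hint : Integrable fun t => ((ContinuousLinearMap.precompL (EuclideanSpace ℝ (Fin d))
      (ContinuousLinearMap.lsmul ℝ ℝ)) (fderiv ℝ η (x - t))) (B.indicator g t) :=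
    ((φ.hasCompactSupport_normed.fderiv ℝ).convolutionExists_left _
      (hη1.continuous_fderiv one_ne_zero) hgB.locallyIntegrable x).integrable_swap
  refine ContinuousLinearMap.opENorm_le_bound _ fun v => ?_
  -- the test function in the definition of the weak gradient
  set ψ : EuclideanSpace ℝ (Fin d) → ℝ := fun y => η (x - y) with hψ
  have hψ0 : ∀ y, y ∉ closedBall x φ.rOut → ψ y = 0 := by
    intro y hy
    have : x - y ∉ tsupport η := by
      rw [hη, φ.tsupport_normed_eq]
      simpa [dist_eq_norm, norm_sub_rev] using hy
    exact image_eq_zero_of_notMem_tsupport (f := η) this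
  have hψK : tsupport ψ ⊆ closedBall x φ.rOut :=
    closure_minimal (fun y hy => by_contra fun h => hy (hψ0 y h)) isClosed_closedBall
  have hψd : ∀ y, fderiv ℝ ψ y v = - fderiv ℝ η (x - y) v := by
    intro y
    have h1 : HasFDerivAt (fun y => x - y) (-(ContinuousLinearMap.id ℝ _)) y := by
      simpa using (hasFDerivAt_id y).const_sub x
    have h2 : HasFDerivAt ψ _ y :=
      ((hη1.differentiable one_ne_zero (x - y)).hasFDerivAt).comp y h1
    rw [h2.fderiv]
    simp
  have hweak := hG.2 ψ (hηs.comp (contDiff_const.sub contDiff_id))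
    (HasCompactSupport.intro (isCompact_closedBall x φ.rOut) hψ0) (hψK.trans (hx.trans hBK)) v
  have hconv : (convolution (fderiv ℝ η) (B.indicator g) (ContinuousLinearMap.precompL
      (EuclideanSpace ℝ (Fin d)) (ContinuousLinearMap.lsmul ℝ ℝ)) volume x) v =
      ∫ y in K, ψ y * inner ℝ (G y) v := by
    rw [convolution_eq_swap, ContinuousLinearMap.integral_apply hint]
    rw [← neg_eq_iff_eq_neg.2 hweak, ← integral_neg, ← integral_indicator hK]
    refine integral_congr_ae (ae_of_all _ fun y => ?_)
    simp only [ContinuousLinearMap.precompL_apply, ContinuousLinearMap.lsmul_apply, smul_eq_mul]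
    by_cases hy : y ∈ B
    · simp only [hy, hBK hy, indicator_of_mem, hψd]
      ring
    · have h0 : fderiv ℝ ψ y = 0 := image_eq_zero_of_notMem_tsupport fun h =>
        hy (hx (hψK (tsupport_fderiv_subset ℝ h)))
      by_cases hyK : y ∈ K <;> simp [hy, hyK, h0]
  rw [hconv]
  calc ‖∫ y in K, ψ y * inner ℝ (G y) v‖ₑ ≤ ∫⁻ y in K, ‖ψ y‖ₑ * ‖G y‖ₑ * ‖v‖ₑ := by
        refine (enorm_integral_le_lintegral_enorm _).trans (lintegral_mono fun y => ?_)
        rw [enorm_mul, mul_assoc]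
        gcongr
        rw [← ofReal_norm, ← ofReal_norm, ← ofReal_norm, ← ENNReal.ofReal_mul (norm_nonneg _)]
        exact ENNReal.ofReal_le_ofReal (norm_inner_le_norm _ _)
    _ = _ := lintegral_mul_const' _ _ enorm_ne_top

/-- Young's inequality for the convolution with a probability density. -/
theorem lintegral_rpow_lintegral_normed_le {p : ℝ} (hp : 1 ≤ p)
    (hG : AEStronglyMeasurable G (volume.restrict K))
    (φ : ContDiffBump (0 : EuclideanSpace ℝ (Fin d))) :
    ∫⁻ x, (∫⁻ y in K, ‖φ.normed volume (x - y)‖ₑ * ‖G y‖ₑ) ^ p ≤ ∫⁻ y in K, ‖G y‖ₑ ^ p := by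
  set η := φ.normed (volume : Measure (EuclideanSpace ℝ (Fin d))) with hη
  have hηc : Continuous η := φ.continuous_normed
  have hGe : AEMeasurable (fun y => ‖G y‖ₑ) (volume.restrict K) := hG.enorm
  have hGp : AEMeasurable (fun y => ‖G y‖ₑ ^ p) (volume.restrict K) := hGe.pow_const p
  have hηm : ∀ x, Measurable fun y => ‖η (x - y)‖ₑ := fun x =>
    (hηc.comp (by fun_prop)).enorm.measurable
  have hx : ∀ x, (∫⁻ y in K, ‖η (x - y)‖ₑ * ‖G y‖ₑ) ^ p ≤
      ∫⁻ y in K, ‖η (x - y)‖ₑ * ‖G y‖ₑ ^ p := by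
    intro x
    set τ := (volume.restrict K).withDensity fun y => ‖η (x - y)‖ₑ with hτ
    have h1 : ∀ {f : EuclideanSpace ℝ (Fin d) → ℝ≥0∞}, AEMeasurable f (volume.restrict K) →
        ∫⁻ y, f y ∂τ = ∫⁻ y in K, ‖η (x - y)‖ₑ * f y := fun hf => by
      rw [hτ, lintegral_withDensity_eq_lintegral_mul₀ (hηm x).aemeasurable hf]
      rfl
    have h2 : τ univ ≤ 1 := by
      rw [hτ, withDensity_apply _ MeasurableSet.univ, Measure.restrict_univ,
        ← lintegral_enorm_normed volume φ,
        ← lintegral_sub_left_eq_self (fun y => ‖φ.normed volume y‖ₑ) x]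
      exact setLIntegral_le_lintegral _ _
    rw [← h1 hGe, ← h1 hGp]
    refine (rpow_lintegral_le (hGe.mono_ac (withDensity_absolutelyContinuous _ _)) hp).trans ?_
    exact mul_le_of_le_one_left' (ENNReal.rpow_le_one h2 (by linarith))
  calc _ ≤ ∫⁻ x, ∫⁻ y in K, ‖η (x - y)‖ₑ * ‖G y‖ₑ ^ p := lintegral_mono hx
    _ = ∫⁻ y in K, ∫⁻ x, ‖η (x - y)‖ₑ * ‖G y‖ₑ ^ p := by
        refine lintegral_lintegral_swap (AEMeasurable.mul ?_ hGp.comp_snd)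
        exact (hηc.comp (by fun_prop : Continuous fun q : EuclideanSpace ℝ (Fin d) ×
          EuclideanSpace ℝ (Fin d) => q.1 - q.2)).enorm.measurable.aemeasurable
    _ = _ := by
        refine lintegral_congr fun y => ?_
        rw [lintegral_mul_const (f := fun x => ‖η (x - y)‖ₑ) _
            (hηc.comp (continuous_id.sub continuous_const)).enorm.measurable,
          lintegral_sub_right_eq_self (fun x => ‖η x‖ₑ), lintegral_enorm_normed, one_mul]

/-- Poincaré's inequality for weak gradients, on a compact convex subset of the domain. It follows
from the one for smooth functions by mollification. -/
theorem IsWeakGradient.lintegral_lintegral_rpow_enorm_sub_le (hK : IsOpen K)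
    (hg : LocallyIntegrableOn g K) (hG : IsWeakGradient K g G) {p : ℝ} (hp : 1 ≤ p)
    {A : Set (EuclideanSpace ℝ (Fin d))} (hA : IsCompact A) (hAc : Convex ℝ A) (hAK : A ⊆ K)
    {D : ℝ≥0∞} (hD : ∀ x ∈ A, ∀ y ∈ A, ‖x - y‖ₑ ≤ D) :
    ∫⁻ x in A, ∫⁻ y in A, ‖g x - g y‖ₑ ^ p ≤
      D ^ p * 2 ^ d * volume A * ∫⁻ x in K, ‖G x‖ₑ ^ p := by
  have hp0 : 0 < p := by linarith
  obtain ⟨δ, hδ, hδK⟩ := hA.exists_cthickening_subset_open hK hAK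
  set B := cthickening δ A with hBdef
  have hB : IsCompact B := hA.cthickening
  have hAB : A ⊆ B := self_subset_cthickening A
  have hgB : Integrable (B.indicator g) :=
    (integrable_indicator_iff hB.measurableSet).2 (hg.integrableOn_compact_subset hδK hB)
  have hr : ∀ n : ℕ, 0 < δ / (n + 1) := fun n => by positivity
  let φ : ℕ → ContDiffBump (0 : EuclideanSpace ℝ (Fin d)) := fun n =>
    ⟨δ / (n + 1) / 2, δ / (n + 1), half_pos (hr n), half_lt_self (hr n)⟩
  let u : ℕ → EuclideanSpace ℝ (Fin d) → ℝ := fun n =>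
    convolution ((φ n).normed volume) (B.indicator g) (ContinuousLinearMap.lsmul ℝ ℝ) volume
  have hu : ∀ n, ContDiff ℝ 1 (u n) := fun n =>
    (φ n).hasCompactSupport_normed.contDiff_convolution_left (n := 1) _ (φ n).contDiff_normed
      hgB.locallyIntegrable
  have hlim : ∀ᵐ x, x ∈ A → Tendsto (fun n => u n x) atTop (𝓝 (g x)) := by
    have h0 : Tendsto (fun n => (φ n).rOut) atTop (𝓝 0) :=
      by
      simpa [φ, div_eq_mul_inv] using
        (tendsto_one_div_add_atTop_nhds_zero_nat (𝕜 := ℝ)).const_mul δ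
    filter_upwards [ContDiffBump.ae_convolution_tendsto_right_of_locallyIntegrable
      (μ := (volume : Measure (EuclideanSpace ℝ (Fin d)))) (K := 2) h0
      (Eventually.of_forall fun n => le_of_eq (by simp [φ]; ring)) hgB.locallyIntegrable]
      with x hx hxA
    rwa [indicator_of_mem (hAB hxA)] at hx
  have hlimA : ∀ᵐ x ∂volume.restrict A, Tendsto (fun n => u n x) atTop (𝓝 (g x)) :=
    (ae_restrict_iff' hA.measurableSet).2 hlim
  have hbound : ∀ n, ∫⁻ x in A, ∫⁻ y in A, ‖u n x - u n y‖ₑ ^ p ≤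
      D ^ p * 2 ^ d * volume A * ∫⁻ x in K, ‖G x‖ₑ ^ p := by
    intro n
    have h1 := _root_.lintegral_lintegral_rpow_enorm_sub_le (μ := volume) (hu n) hp
      hA.measurableSet hAc hA.measure_lt_top.ne hD
    rw [finrank_euclideanSpace_fin] at h1
    refine h1.trans ?_
    gcongr D ^ p * 2 ^ d * volume A * ?_
    refine le_trans ?_ (lintegral_rpow_lintegral_normed_le hp hG.1.aestronglyMeasurable (φ n))
    refine (setLIntegral_mono' hA.measurableSet fun x hx => ?_).trans
      (setLIntegral_le_lintegral A _)
    gcongr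
    refine enorm_fderiv_convolution_le hB hδK hK.measurableSet hg hG (φ n) fun y hy => ?_
    refine mem_cthickening_of_dist_le y x δ A hx ((mem_closedBall.1 hy).trans ?_)
    exact div_le_self hδ.le (by linarith [n.cast_nonneg (α := ℝ)])
  have hcont : Continuous fun t : ℝ => ‖t‖ₑ ^ p :=
    ENNReal.continuous_rpow_const.comp continuous_enorm
  have huc : ∀ n, Continuous (u n) := fun n => (hu n).continuous
  have hmeas : ∀ n, Measurable fun q : EuclideanSpace ℝ (Fin d) × EuclideanSpace ℝ (Fin d) =>
      ‖u n q.1 - u n q.2‖ₑ ^ p := fun n =>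
    (hcont.comp (((huc n).comp continuous_fst).sub ((huc n).comp continuous_snd))).measurable
  -- Fatou's lemma, in both variables
  calc ∫⁻ x in A, ∫⁻ y in A, ‖g x - g y‖ₑ ^ p
      ≤ ∫⁻ x in A, liminf (fun n => ∫⁻ y in A, ‖u n x - u n y‖ₑ ^ p) atTop := by
        refine lintegral_mono_ae ?_
        filter_upwards [hlimA] with x hx
        refine le_trans (lintegral_mono_ae ?_) (lintegral_liminf_le'
          fun n => ((hmeas n).comp measurable_prodMk_left).aemeasurable)
        filter_upwards [hlimA] with y hy
        exact (((hcont.tendsto _).comp (hx.sub hy)).liminf_eq).ge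
    _ ≤ liminf (fun n => ∫⁻ x in A, ∫⁻ y in A, ‖u n x - u n y‖ₑ ^ p) atTop :=
        lintegral_liminf_le' fun n => ((hmeas n).lintegral_prod_right').aemeasurable
    _ ≤ _ := (liminf_le_liminf (Eventually.of_forall hbound)).trans_eq (liminf_const _)

end WeakGradient

/-! ### The oscillation bound and Lebesgue points -/

section Oscillation

variable {d : ℕ}

/-- The common feature of the seminorms `|·|_{W^{s,p}(K)}` from which Hölder continuity is derived:
a scaling-invariant bound for the oscillation of `g` over compact convex subsets of `K`. The role of
`S` is played by the seminorm of `g`. -/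
def HasOscillationBound (s p : ℝ) (M : NNReal) (K : Set (EuclideanSpace ℝ (Fin d)))
    (g : EuclideanSpace ℝ (Fin d) → ℝ) (S : ℝ≥0∞) : Prop :=
  ∀ A ⊆ K, IsCompact A → Convex ℝ A → ∀ (a : EuclideanSpace ℝ (Fin d)) (r : ℝ), 0 < r →
    A ⊆ closedBall a r →
    ∫⁻ x in A, ∫⁻ y in A, ‖g x - g y‖ₑ ^ p ≤ M * ENNReal.ofReal (r ^ ((d : ℝ) + s * p)) * S ^ p

theorem enorm_sub_le_of_subset_closedBall {A : Set (EuclideanSpace ℝ (Fin d))}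
    {a : EuclideanSpace ℝ (Fin d)} {r : ℝ} (hA : A ⊆ closedBall a r) :
    ∀ x ∈ A, ∀ y ∈ A, ‖x - y‖ₑ ≤ ENNReal.ofReal (2 * r) := by
  intro x hx y hy
  rw [← ofReal_norm, ← dist_eq_norm]
  apply ENNReal.ofReal_le_ofReal
  have h1 := mem_closedBall.1 (hA hx)
  have h2 := mem_closedBall'.1 (hA hy)
  linarith [dist_triangle x a y]

theorem rpow_gagliardoSeminorm {s p : ℝ} (hp : 1 ≤ p) (K : Set (EuclideanSpace ℝ (Fin d)))
    (g : EuclideanSpace ℝ (Fin d) → ℝ) : gagliardoSeminorm s p K g ^ p =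
      ∫⁻ x in K, ∫⁻ y in K, ‖g x - g y‖ₑ ^ p / edist x y ^ ((d : ℝ) + s * p) := by
  rw [gagliardoSeminorm, ← ENNReal.rpow_mul, one_div_mul_cancel (by linarith), ENNReal.rpow_one]

/-- Over two sets `A, B ⊆ K`, each point of `A` within distance `D` of each point of `B`. -/
theorem lintegral_lintegral_le_gagliardoSeminorm {s p : ℝ} (hp : 1 ≤ p) (hs : 0 < s)
    {K : Set (EuclideanSpace ℝ (Fin d))} (g : EuclideanSpace ℝ (Fin d) → ℝ)
    {A B : Set (EuclideanSpace ℝ (Fin d))} (hA : MeasurableSet A) (hB : MeasurableSet B)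
    (hAK : A ⊆ K) (hBK : B ⊆ K) {D : ℝ≥0∞} (hD : ∀ x ∈ A, ∀ y ∈ B, ‖x - y‖ₑ ≤ D) (hDt : D ≠ ∞) :
    ∫⁻ x in A, ∫⁻ y in B, ‖g x - g y‖ₑ ^ p ≤
      D ^ ((d : ℝ) + s * p) * gagliardoSeminorm s p K g ^ p := by
  have hp0 : 0 < p := by linarith
  have hb : 0 < (d : ℝ) + s * p := by positivity
  have hDb : D ^ ((d : ℝ) + s * p) ≠ ∞ := ENNReal.rpow_ne_top_of_nonneg hb.le hDt
  rw [rpow_gagliardoSeminorm hp, ← lintegral_const_mul' _ _ hDb]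
  refine (setLIntegral_mono' hA fun x hx => ?_).trans (lintegral_mono_set hAK)
  rw [← lintegral_const_mul' _ _ hDb]
  refine (setLIntegral_mono' hB fun y hy => ?_).trans (lintegral_mono_set hBK)
  rcases eq_or_ne x y with rfl | hxy
  · simp [hp0]
  · have h0 : edist x y ^ ((d : ℝ) + s * p) ≠ 0 := by
      simp [ENNReal.rpow_eq_zero_iff, hxy, edist_ne_top]
    have ht : edist x y ^ ((d : ℝ) + s * p) ≠ ∞ :=
      ENNReal.rpow_ne_top_of_nonneg hb.le (edist_ne_top _ _)
    calc ‖g x - g y‖ₑ ^ p = edist x y ^ ((d : ℝ) + s * p) *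
          (‖g x - g y‖ₑ ^ p / edist x y ^ ((d : ℝ) + s * p)) := (ENNReal.mul_div_cancel h0 ht).symm
      _ ≤ _ := by
        gcongr
        rw [edist_eq_enorm_sub]
        exact hD x hx y hy

theorem exists_hasOscillationBound (d : ℕ) {s p : ℝ} (hp : 1 ≤ p) (hs : 0 < s) :
    ∃ M : NNReal, ∀ (K : Set (EuclideanSpace ℝ (Fin d))) (g : EuclideanSpace ℝ (Fin d) → ℝ),
      IsOpen K → LocallyIntegrableOn g K → sobolevSeminorm s p K g ≠ ∞ →
      HasOscillationBound s p M K g (sobolevSeminorm s p K g) := by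
  have hp0 : 0 < p := by linarith
  by_cases hs1 : s = 1
  · subst hs1
    set ω := volume (ball (0 : EuclideanSpace ℝ (Fin d)) 1) with hω
    have hωt : ω ≠ ∞ := measure_ball_lt_top.ne
    refine ⟨(ENNReal.ofReal (2 ^ p) * 2 ^ d * ω).toNNReal,
      fun K g hK hg hfin A hAK hA hAc a r hr har => ?_⟩
    rw [ENNReal.coe_toNNReal (ENNReal.mul_ne_top (by finiteness) hωt)]
    rw [sobolevSeminorm, if_pos rfl] at hfin ⊢
    set X := ∫⁻ x in A, ∫⁻ y in A, ‖g x - g y‖ₑ ^ p with hX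
    set c := ENNReal.ofReal (2 ^ p) * 2 ^ d * ω * ENNReal.ofReal (r ^ ((d : ℝ) + 1 * p)) with hc
    have hct : c ≠ ∞ := ENNReal.mul_ne_top (ENNReal.mul_ne_top (by finiteness) hωt) (by finiteness)
    have key : ∀ t, gradientSeminorm p K g < t → X ≤ c * t ^ p := by
      intro t ht
      simp only [gradientSeminorm, iInf_lt_iff] at ht
      obtain ⟨G, hG, hGt⟩ := ht
      have h1 := hG.lintegral_lintegral_rpow_enorm_sub_le hK hg hp hA hAc hAK
        (enorm_sub_le_of_subset_closedBall har)
      have h2 : ∫⁻ x in K, ‖G x‖ₑ ^ p ≤ t ^ p := by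
        rw [eLpNorm_eq_lintegral_rpow_enorm_toReal (by simpa using hp0) ENNReal.ofReal_ne_top,
          ENNReal.toReal_ofReal hp0.le] at hGt
        have := ENNReal.rpow_le_rpow hGt.le hp0.le
        rwa [← ENNReal.rpow_mul, one_div_mul_cancel hp0.ne', ENNReal.rpow_one] at this
      refine h1.trans ?_
      have h3 : volume A ≤ ENNReal.ofReal (r ^ d) * ω := by
        refine (measure_mono har).trans_eq ?_
        rw [Measure.addHaar_closedBall _ _ hr.le, finrank_euclideanSpace_fin]
      calc _ ≤ ENNReal.ofReal (2 * r) ^ p * 2 ^ d * (ENNReal.ofReal (r ^ d) * ω) * t ^ p := by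
            gcongr
        _ = c * t ^ p := by
            rw [hc, ENNReal.ofReal_rpow_of_nonneg (by positivity) hp0.le,
              Real.mul_rpow two_pos.le hr.le,
              ENNReal.ofReal_mul (by positivity), one_mul, Real.rpow_add hr, Real.rpow_natCast,
              ENNReal.ofReal_mul (by positivity)]
            ring
    have hcont : Tendsto (fun t : ℝ≥0∞ => c * t ^ p) (𝓝[>] gradientSeminorm p K g)
        (𝓝 (c * gradientSeminorm p K g ^ p)) :=
      ENNReal.Tendsto.const_mul ((ENNReal.continuous_rpow_const.tendsto _).mono_left
        nhdsWithin_le_nhds) (Or.inr hct)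
    have : (𝓝[>] gradientSeminorm p K g).NeBot := nhdsGT_neBot_of_exists_gt ⟨∞, hfin.lt_top⟩
    exact ge_of_tendsto hcont (eventually_nhdsWithin_of_forall key)
  · refine ⟨(ENNReal.ofReal (2 ^ ((d : ℝ) + s * p))).toNNReal,
      fun K g hK hg hfin A hAK hA hAc a r hr har => ?_⟩
    rw [ENNReal.coe_toNNReal ENNReal.ofReal_ne_top, sobolevSeminorm, if_neg hs1,
      ← ENNReal.ofReal_mul (by positivity), ← Real.mul_rpow two_pos.le hr.le,
      ← ENNReal.ofReal_rpow_of_nonneg (by positivity) (by positivity)]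
    exact lintegral_lintegral_le_gagliardoSeminorm hp hs g hA.measurableSet hA.measurableSet hAK hAK
      (enorm_sub_le_of_subset_closedBall har) ENNReal.ofReal_ne_top

theorem HasOscillationBound.congr {s p : ℝ} {M : NNReal} {K : Set (EuclideanSpace ℝ (Fin d))}
    {g h : EuclideanSpace ℝ (Fin d) → ℝ} {S : ℝ≥0∞} (hg : HasOscillationBound s p M K g S)
    (hgh : h =ᵐ[volume.restrict K] g) : HasOscillationBound s p M K h S := by
  intro A hAK hA hAc a r hr har
  have hA' : h =ᵐ[volume.restrict A] g := ae_restrict_of_ae_restrict_of_subset hAK hgh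
  refine le_trans (le_of_eq ?_) (hg A hAK hA hAc a r hr har)
  refine lintegral_congr_ae ?_
  filter_upwards [hA'] with x hx
  refine lintegral_congr_ae ?_
  filter_upwards [hA'] with y hy
  rw [hx, hy]

/-- `x` is a Lebesgue point of `g`. -/
def IsLebesguePoint (g : EuclideanSpace ℝ (Fin d) → ℝ) (x : EuclideanSpace ℝ (Fin d)) : Prop :=
  Tendsto (fun r : ℝ => (∫⁻ y in closedBall x r, ‖g y - g x‖ₑ) / volume (closedBall x r))
    (𝓝[>] 0) (𝓝 0)

theorem IsLebesguePoint.of_continuousAt {g : EuclideanSpace ℝ (Fin d) → ℝ}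
    {x : EuclideanSpace ℝ (Fin d)} (hg : ContinuousAt g x) : IsLebesguePoint g x := by
  refine ENNReal.tendsto_nhds_zero.2 fun ε hε => ?_
  have h1 : ∀ᶠ y in 𝓝 x, edist (g y) (g x) < ε := hg.eventually (eball_mem_nhds _ hε)
  obtain ⟨δ, hδ, h2⟩ := Metric.eventually_nhds_iff_ball.1 h1
  filter_upwards [Ioo_mem_nhdsGT hδ] with r hr
  refine ENNReal.div_le_of_le_mul ?_
  calc ∫⁻ y in closedBall x r, ‖g y - g x‖ₑ ≤ ∫⁻ _ in closedBall x r, ε := by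
        refine setLIntegral_mono measurable_const fun y hy => ?_
        rw [← edist_eq_enorm_sub]
        exact (h2 y (closedBall_subset_ball hr.2 hy)).le
    _ = _ := setLIntegral_const _ _

theorem ae_isLebesguePoint {K : Set (EuclideanSpace ℝ (Fin d))} (hK : IsOpen K)
    {g : EuclideanSpace ℝ (Fin d) → ℝ} (hg : LocallyIntegrableOn g K) :
    ∀ᵐ x, x ∈ K → IsLebesguePoint g x := by
  obtain ⟨u, hu, hKu, hgu⟩ := hg.exists_nat_integrableOn
  have h1 : ∀ n, ∀ᵐ x, x ∈ u n ∩ K → IsLebesguePoint g x := by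
    intro n
    have ho : IsOpen (u n ∩ K) := (hu n).inter hK
    have hi : Integrable ((u n ∩ K).indicator g) :=
      (integrable_indicator_iff ho.measurableSet).2 (hgu n)
    filter_upwards [(Besicovitch.vitaliFamily volume).ae_tendsto_lintegral_enorm_sub_div
      hi.locallyIntegrable] with x hx hxu
    refine (hx.comp (Besicovitch.tendsto_filterAt volume x)).congr' ?_
    obtain ⟨δ, hδ, h2⟩ := Metric.isOpen_iff.1 ho x hxu
    filter_upwards [Ioo_mem_nhdsGT hδ] with r hr
    simp only [Function.comp]
    congr 1
    refine setLIntegral_congr_fun measurableSet_closedBall fun y hy => ?_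
    rw [indicator_of_mem hxu, indicator_of_mem (h2 (closedBall_subset_ball hr.2 hy))]
  filter_upwards [ae_all_iff.2 h1] with x hx hxK
  obtain ⟨n, hn⟩ := mem_iUnion.1 (hKu hxK)
  exact hx n ⟨hn, hxK⟩

end Oscillation

/-! ### Morrey's estimate -/

section Morrey

variable {d : ℕ}

theorem rpow_edist_integral_le {α : Type*} [MeasurableSpace α] {P Q : Measure α}
    [IsProbabilityMeasure P] [IsProbabilityMeasure Q] {g : α → ℝ} (hP : Integrable g P)
    (hQ : Integrable g Q) {p : ℝ} (hp : 1 ≤ p) :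
    edist (∫ x, g x ∂P) (∫ x, g x ∂Q) ^ p ≤ ∫⁻ x, ∫⁻ y, ‖g x - g y‖ₑ ^ p ∂Q ∂P := by
  have hp0 : 0 ≤ p := by linarith
  have hjensen : ∀ {τ : Measure α} [IsProbabilityMeasure τ] (c : ℝ), Integrable g τ →
      edist (∫ x, g x ∂τ) c ^ p ≤ ∫⁻ x, ‖g x - c‖ₑ ^ p ∂τ := by
    intro τ _ c hτ
    have h1 : (∫ x, g x ∂τ) - c = ∫ x, (g x - c) ∂τ := by
      rw [integral_sub hτ (integrable_const c)]; simp
    rw [edist_eq_enorm_sub, h1]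
    refine (ENNReal.rpow_le_rpow (enorm_integral_le_lintegral_enorm _) hp0).trans ?_
    refine (rpow_lintegral_le (hτ.1.sub aestronglyMeasurable_const).enorm hp).trans ?_
    simp
  refine (hjensen _ hP).trans (lintegral_mono fun x => ?_)
  rw [← edist_eq_enorm_sub, edist_comm]
  refine (hjensen _ hQ).trans (le_of_eq (lintegral_congr fun y => ?_))
  rw [enorm_sub_rev]

theorem isProbabilityMeasure_inv_smul_restrict {α : Type*} [MeasurableSpace α] {μ : Measure α}
    {A : Set α} (h0 : μ A ≠ 0) (ht : μ A ≠ ∞) :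
    IsProbabilityMeasure ((μ A)⁻¹ • μ.restrict A) :=
  ⟨by simp [ENNReal.inv_mul_cancel h0 ht]⟩

theorem rpow_edist_setAverage_le {α : Type*} [MeasurableSpace α] {μ : Measure α} {A B : Set α}
    (hA0 : μ A ≠ 0) (hAt : μ A ≠ ∞) (hB0 : μ B ≠ 0) (hBt : μ B ≠ ∞) {g : α → ℝ}
    (hA : IntegrableOn g A μ) (hB : IntegrableOn g B μ) {p : ℝ} (hp : 1 ≤ p) :
    edist (⨍ x in A, g x ∂μ) (⨍ x in B, g x ∂μ) ^ p ≤
      (μ A)⁻¹ * ((μ B)⁻¹ * ∫⁻ x in A, ∫⁻ y in B, ‖g x - g y‖ₑ ^ p ∂μ ∂μ) := by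
  have := isProbabilityMeasure_inv_smul_restrict hA0 hAt
  have := isProbabilityMeasure_inv_smul_restrict hB0 hBt
  have h := rpow_edist_integral_le (hA.smul_measure (ENNReal.inv_ne_top.2 hA0))
    (hB.smul_measure (ENNReal.inv_ne_top.2 hB0)) hp
  simp only [average, Measure.restrict_apply_univ]
  refine h.trans (le_of_eq ?_)
  simp only [lintegral_smul_measure, smul_eq_mul]
  rw [lintegral_const_mul' _ _ (ENNReal.inv_ne_top.2 hB0)]

/-- If the oscillation is bounded on `A`, then the averages over `A` and over a comparably large
subset are close. -/
theorem exists_edist_setAverage_le (d : ℕ) {s p : ℝ} (hp : 1 ≤ p) (M : NNReal) {η : ℝ}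
    (hη : 0 < η) :
    ∃ C : NNReal, ∀ (K : Set (EuclideanSpace ℝ (Fin d))) (g : EuclideanSpace ℝ (Fin d) → ℝ)
      (S : ℝ≥0∞), HasOscillationBound s p M K g S → ∀ A B : Set (EuclideanSpace ℝ (Fin d)),
      A ⊆ K → IsCompact A → Convex ℝ A → IntegrableOn g A → B ⊆ A →
      ∀ (a : EuclideanSpace ℝ (Fin d)) (r : ℝ), 0 < r → A ⊆ closedBall a r →
      ENNReal.ofReal ((η * r) ^ d) * volume (ball (0 : EuclideanSpace ℝ (Fin d)) 1) ≤ volume B →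
      edist (⨍ x in A, g x) (⨍ x in B, g x) ≤ C * ENNReal.ofReal (r ^ (s - d / p)) * S := by
  have hp0 : 0 < p := by linarith
  set ω := volume (ball (0 : EuclideanSpace ℝ (Fin d)) 1) with hω
  have hωt : ω ≠ ∞ := measure_ball_lt_top.ne
  have hω0 : ω ≠ 0 := (measure_ball_pos _ _ one_pos).ne'
  set c : ℝ≥0∞ := M * (ENNReal.ofReal ((η ^ d)⁻¹) * ω⁻¹) ^ 2 with hc
  have hct : c ≠ ∞ := by
    have : ω⁻¹ ≠ ∞ := ENNReal.inv_ne_top.2 hω0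
    finiteness
  refine ⟨(c ^ (1 / p)).toNNReal, fun K g S hg A B hAK hA hAc hgA hBA a r hr har hvol => ?_⟩
  rw [ENNReal.coe_toNNReal (ENNReal.rpow_ne_top_of_nonneg (by positivity) hct)]
  have hvA : volume A ≠ ∞ := hA.measure_lt_top.ne
  have hvB : volume B ≠ ∞ := ((measure_mono hBA).trans_lt hA.measure_lt_top).ne
  have hpos : ENNReal.ofReal ((η * r) ^ d) * ω ≠ 0 :=
    mul_ne_zero (ENNReal.ofReal_pos.2 (by positivity)).ne' hω0
  have hB0 : volume B ≠ 0 := (hpos.bot_lt.trans_le hvol).ne'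
  have hA0 : volume A ≠ 0 := (hpos.bot_lt.trans_le (hvol.trans (measure_mono hBA))).ne'
  have hinv : (ENNReal.ofReal ((η * r) ^ d) * ω)⁻¹ =
      ENNReal.ofReal ((η ^ d)⁻¹) * ω⁻¹ * ENNReal.ofReal ((r ^ d)⁻¹) := by
    rw [ENNReal.mul_inv (Or.inr hωt) (Or.inr hω0), ← ENNReal.ofReal_inv_of_pos (by positivity),
      mul_pow, mul_inv, ENNReal.ofReal_mul (by positivity)]
    ring
  rw [← ENNReal.rpow_le_rpow_iff hp0]
  calc edist (⨍ x in A, g x) (⨍ x in B, g x) ^ p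
      ≤ (volume A)⁻¹ * ((volume B)⁻¹ * ∫⁻ x in A, ∫⁻ y in B, ‖g x - g y‖ₑ ^ p) :=
        rpow_edist_setAverage_le hA0 hvA hB0 hvB hgA (hgA.mono_set hBA) hp
    _ ≤ (ENNReal.ofReal ((η * r) ^ d) * ω)⁻¹ * ((ENNReal.ofReal ((η * r) ^ d) * ω)⁻¹ *
          (M * ENNReal.ofReal (r ^ ((d : ℝ) + s * p)) * S ^ p)) := by
        have h1 : ∫⁻ x in A, ∫⁻ y in B, ‖g x - g y‖ₑ ^ p ≤
            M * ENNReal.ofReal (r ^ ((d : ℝ) + s * p)) * S ^ p :=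
          (lintegral_mono fun x => lintegral_mono_set hBA).trans (hg A hAK hA hAc a r hr har)
        gcongr
        exact hvol.trans (measure_mono hBA)
    _ = c * (ENNReal.ofReal ((r ^ d)⁻¹) * ENNReal.ofReal ((r ^ d)⁻¹) *
          ENNReal.ofReal (r ^ ((d : ℝ) + s * p))) * S ^ p := by
        rw [hinv, hc]; ring
    _ = (c ^ (1 / p) * ENNReal.ofReal (r ^ (s - d / p)) * S) ^ p := by
        rw [ENNReal.mul_rpow_of_nonneg _ _ hp0.le, ENNReal.mul_rpow_of_nonneg _ _ hp0.le,
          ← ENNReal.rpow_mul, one_div_mul_cancel hp0.ne', ENNReal.rpow_one,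
          ENNReal.ofReal_rpow_of_nonneg (by positivity) hp0.le,
          ← ENNReal.ofReal_mul (by positivity),
          ← ENNReal.ofReal_mul (by positivity), ← Real.rpow_mul hr.le]
        congr 3
        rw [← Real.rpow_natCast, ← Real.rpow_neg hr.le, ← Real.rpow_add hr, ← Real.rpow_add hr]
        congr 1
        field_simp
        ring

theorem tendsto_setAverage_of_isLebesguePoint {g : EuclideanSpace ℝ (Fin d) → ℝ}
    {x : EuclideanSpace ℝ (Fin d)} (hx : IsLebesguePoint g x)
    {A : ℕ → Set (EuclideanSpace ℝ (Fin d))} {ρ : ℕ → ℝ} (hρ0 : ∀ k, 0 < ρ k)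
    (hρ : Tendsto ρ atTop (𝓝 0)) (hA : ∀ k, A k ⊆ closedBall x (ρ k))
    (hgA : ∀ k, IntegrableOn g (A k)) {c : ℝ} (hc : 0 < c)
    (hvol : ∀ k, ENNReal.ofReal c * volume (closedBall x (ρ k)) ≤ volume (A k)) :
    Tendsto (fun k => ⨍ y in A k, g y) atTop (𝓝 (g x)) := by
  have hlim : Tendsto (fun k => (ENNReal.ofReal c)⁻¹ *
      ((∫⁻ y in closedBall x (ρ k), ‖g y - g x‖ₑ) / volume (closedBall x (ρ k)))) atTop (𝓝 0) := by
    have h1 : Tendsto ρ atTop (𝓝[>] 0) :=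
      tendsto_nhdsWithin_iff.2 ⟨hρ, Eventually.of_forall hρ0⟩
    have := ENNReal.Tendsto.const_mul (hx.comp h1) (a := (ENNReal.ofReal c)⁻¹)
      (Or.inr (ENNReal.inv_ne_top.2 (ENNReal.ofReal_pos.2 hc).ne'))
    simpa using this
  refine tendsto_iff_edist_tendsto_0.2 (tendsto_of_tendsto_of_tendsto_of_le_of_le
    tendsto_const_nhds hlim (fun _ => zero_le) fun k => ?_)
  have hb0 : volume (closedBall x (ρ k)) ≠ 0 := (measure_closedBall_pos _ _ (hρ0 k)).ne'
  have hbt : volume (closedBall x (ρ k)) ≠ ∞ := measure_closedBall_lt_top.ne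
  have hpos : ENNReal.ofReal c * volume (closedBall x (ρ k)) ≠ 0 :=
    mul_ne_zero (ENNReal.ofReal_pos.2 hc).ne' hb0
  have hA0 : volume (A k) ≠ 0 := (hpos.bot_lt.trans_le (hvol k)).ne'
  have hAt : volume (A k) ≠ ∞ := ((measure_mono (hA k)).trans_lt measure_closedBall_lt_top).ne
  have := isProbabilityMeasure_inv_smul_restrict hA0 hAt
  have hi := (hgA k).smul_measure (ENNReal.inv_ne_top.2 hA0)
  simp only [average, Measure.restrict_apply_univ]
  have h1 : (∫ y, g y ∂(volume (A k))⁻¹ • volume.restrict (A k)) - g x =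
      ∫ y, (g y - g x) ∂(volume (A k))⁻¹ • volume.restrict (A k) := by
    rw [integral_sub hi (integrable_const _)]; simp
  rw [edist_eq_enorm_sub, h1]
  refine (enorm_integral_le_lintegral_enorm _).trans ?_
  rw [lintegral_smul_measure, smul_eq_mul, ENNReal.div_eq_inv_mul, ← mul_assoc,
    ← ENNReal.mul_inv (Or.inr hbt) (Or.inr hb0)]
  exact mul_le_mul' (ENNReal.inv_le_inv.2 (hvol k)) (lintegral_mono_set (hA k))

/-- Morrey's estimate at one point: telescoping over the contractions of `A` towards `x` by the
factors `2⁻ᵏ`, whose averages of `g` converge to `g x`, compares `g x` with the average over `A`. -/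
theorem exists_edist_setAverage_isLebesguePoint_le (d : ℕ) {s p : ℝ} (hp : 1 ≤ p)
    (hs : 0 < s - d / p) (M : NNReal) {η : ℝ} (hη : 0 < η) :
    ∃ C : NNReal, ∀ (K : Set (EuclideanSpace ℝ (Fin d))) (g : EuclideanSpace ℝ (Fin d) → ℝ)
      (S : ℝ≥0∞), HasOscillationBound s p M K g S → ∀ A : Set (EuclideanSpace ℝ (Fin d)),
      A ⊆ K → IsCompact A → Convex ℝ A → IntegrableOn g A →
      ∀ (a b : EuclideanSpace ℝ (Fin d)) (r : ℝ), 0 < r → A ⊆ closedBall a r →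
      closedBall b (η * r) ⊆ A → ∀ x ∈ A, IsLebesguePoint g x →
      edist (⨍ y in A, g y) (g x) ≤ C * ENNReal.ofReal (r ^ (s - d / p)) * S := by
  obtain ⟨C, hC⟩ := exists_edist_setAverage_le d (s := s) hp M (half_pos hη)
  set α := s - d / p with hα
  set q := ENNReal.ofReal ((1 / 2) ^ α) with hq
  have hq1 : q < 1 := by
    rw [hq, ENNReal.ofReal_lt_one]
    exact Real.rpow_lt_one (by norm_num) (by norm_num) hs
  have hTt : (1 - q)⁻¹ ≠ ∞ := ENNReal.inv_ne_top.2 (tsub_pos_of_lt hq1).ne'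
  refine ⟨C * ((1 - q)⁻¹).toNNReal, fun K g S hg A hAK hA hAc hgA a b r hr har hbA x hx hxL => ?_⟩
  rw [ENNReal.coe_mul, ENNReal.coe_toNNReal hTt]
  set ω := volume (ball (0 : EuclideanSpace ℝ (Fin d)) 1) with hω
  have hvolA : ENNReal.ofReal ((η * r) ^ d) * ω ≤ volume A := by
    refine le_trans (le_of_eq ?_) (measure_mono hbA)
    rw [Measure.addHaar_closedBall _ _ (by positivity), finrank_euclideanSpace_fin]
  set h : ℝ → EuclideanSpace ℝ (Fin d) → EuclideanSpace ℝ (Fin d) :=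
    fun t => AffineMap.homothety x t with hh
  have hh_apply : ∀ t y, h t y = x + t • (y - x) := fun t y => by
    simp [hh, AffineMap.homothety_apply, add_comm]
  let T : ℕ → Set (EuclideanSpace ℝ (Fin d)) := fun k => h ((1 / 2) ^ k) '' A
  have hT0 : T 0 = A := by simp [T, hh]
  have hTsucc : ∀ k, T (k + 1) ⊆ T k := by
    rintro k _ ⟨y, hy, rfl⟩
    refine ⟨x + (1 / 2 : ℝ) • (y - x), ?_, ?_⟩
    · have := hAc hx hy (a := 1 / 2) (b := 1 / 2) (by norm_num) (by norm_num) (by norm_num)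
      convert this using 1
      module
    · simp only [hh_apply, pow_succ]
      module
  have hTA : ∀ k, T k ⊆ A := by
    intro k
    induction k with
    | zero => exact hT0.subset
    | succ k ih => exact (hTsucc k).trans ih
  have hTc : ∀ k, IsCompact (T k) := fun k => by
    refine hA.image ?_
    have : h ((1 / 2) ^ k) = fun y => x + ((1 / 2 : ℝ) ^ k) • (y - x) := funext (hh_apply _)
    rw [this]
    fun_prop
  have hTconv : ∀ k, Convex ℝ (T k) := fun k => hAc.affine_image _
  have hTball : ∀ k, T k ⊆ closedBall (h ((1 / 2) ^ k) a) ((1 / 2) ^ k * r) := by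
    rintro k _ ⟨y, hy, rfl⟩
    rw [mem_closedBall, hh_apply, hh_apply, dist_eq_norm]
    have h1 : x + ((1 / 2 : ℝ) ^ k) • (y - x) - (x + ((1 / 2 : ℝ) ^ k) • (a - x)) =
        ((1 / 2 : ℝ) ^ k) • (y - a) := by module
    rw [h1, norm_smul, Real.norm_of_nonneg (by positivity)]
    gcongr
    rw [← dist_eq_norm]
    exact har hy
  have hTvol : ∀ k, ENNReal.ofReal ((η * ((1 / 2) ^ k * r)) ^ d) * ω ≤ volume (T k) := by
    intro k
    have h1 : volume (T k) = ENNReal.ofReal (((1 / 2 : ℝ) ^ k) ^ d) * volume A := by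
      rw [Measure.addHaar_image_homothety, finrank_euclideanSpace_fin, abs_of_nonneg (by positivity)]
    rw [h1, show η * ((1 / 2) ^ k * r) = (1 / 2) ^ k * (η * r) by ring, mul_pow,
      ENNReal.ofReal_mul (by positivity), mul_assoc]
    gcongr
  have hTx : ∀ k, T k ⊆ closedBall x (2 * ((1 / 2) ^ k * r)) := by
    intro k y hy
    have hxk : x ∈ T k := ⟨x, hx, by simp [hh_apply]⟩
    have h1 := mem_closedBall.1 (hTball k hy)
    have h2 := mem_closedBall'.1 (hTball k hxk)
    rw [mem_closedBall]
    linarith [dist_triangle y (h ((1 / 2) ^ k) a) x]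
  have hρ : Tendsto (fun k : ℕ => 2 * ((1 / 2 : ℝ) ^ k * r)) atTop (𝓝 0) := by
    simpa using ((tendsto_pow_atTop_nhds_zero_of_lt_one (r := (1 / 2 : ℝ)) (by norm_num)
      (by norm_num)).mul_const r).const_mul 2
  have hlim : Tendsto (fun k => ⨍ y in T k, g y) atTop (𝓝 (g x)) := by
    refine tendsto_setAverage_of_isLebesguePoint hxL (fun k => by positivity) hρ hTx
      (fun k => hgA.mono_set (hTA k)) (c := (η / 2) ^ d) (by positivity) fun k => ?_
    refine le_trans (le_of_eq ?_) (hTvol k)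
    rw [Measure.addHaar_closedBall _ _ (by positivity), finrank_euclideanSpace_fin, ← mul_assoc,
      ← ENNReal.ofReal_mul (by positivity), ← mul_pow]
    congr 3
    ring
  have hstep : ∀ k, edist (⨍ y in T k, g y) (⨍ y in T k.succ, g y) ≤
      C * ENNReal.ofReal (r ^ α) * S * q ^ k := by
    intro k
    have h1 := hC K g S hg (T k) (T (k + 1)) ((hTA k).trans hAK) (hTc k) (hTconv k)
      (hgA.mono_set (hTA k)) (hTsucc k) _ _ (by positivity) (hTball k) (by
        refine le_trans (le_of_eq ?_) (hTvol (k + 1))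
        congr 3
        ring)
    refine h1.trans (le_of_eq ?_)
    rw [Real.mul_rpow (by positivity) hr.le, ENNReal.ofReal_mul (by positivity), hq,
      ← ENNReal.ofReal_pow (by positivity), ← Real.rpow_natCast, ← Real.rpow_natCast,
      ← Real.rpow_mul (by norm_num), ← Real.rpow_mul (by norm_num), mul_comm (k : ℝ)]
    ring
  have := edist_le_tsum_of_edist_le_of_tendsto₀ _ hstep hlim
  rw [hT0, ENNReal.tsum_mul_left, ENNReal.tsum_geometric] at this
  refine this.trans (le_of_eq ?_)
  ring

/-- Morrey's estimate for two points of a compact convex set of comparable inner and outer radii. -/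
theorem exists_edist_isLebesguePoint_le (d : ℕ) {s p : ℝ} (hp : 1 ≤ p)
    (hs : 0 < s - d / p) (M : NNReal) {η : ℝ} (hη : 0 < η) :
    ∃ C : NNReal, ∀ (K : Set (EuclideanSpace ℝ (Fin d))) (g : EuclideanSpace ℝ (Fin d) → ℝ)
      (S : ℝ≥0∞), LocallyIntegrableOn g K → HasOscillationBound s p M K g S →
      ∀ A : Set (EuclideanSpace ℝ (Fin d)), A ⊆ K → IsCompact A → Convex ℝ A →
      ∀ (a b : EuclideanSpace ℝ (Fin d)) (r : ℝ), 0 < r → A ⊆ closedBall a r →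
      closedBall b (η * r) ⊆ A → ∀ x ∈ A, ∀ y ∈ A, IsLebesguePoint g x → IsLebesguePoint g y →
      edist (g x) (g y) ≤ C * ENNReal.ofReal (r ^ (s - d / p)) * S := by
  obtain ⟨C, hC⟩ := exists_edist_setAverage_isLebesguePoint_le d hp hs M hη
  refine ⟨C + C, fun K g S hgl hg A hAK hA hAc a b r hr har hb x hx y hy hxL hyL => ?_⟩
  have hgA := hgl.integrableOn_compact_subset hAK hA
  have h1 := hC K g S hg A hAK hA hAc hgA a b r hr har hb x hx hxL
  have h2 := hC K g S hg A hAK hA hAc hgA a b r hr har hb y hy hyL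
  rw [ENNReal.coe_add, add_mul, add_mul]
  refine (edist_triangle_left _ _ _).trans (add_le_add h1 h2)

end Morrey

/-! ### Continuous representatives and the oscillation distance -/

section Representative

variable {d : ℕ} {s p : ℝ} {K : Set (EuclideanSpace ℝ (Fin d))}

theorem ofReal_dist_rpow {X : Type*} [PseudoMetricSpace X] (x y : X) {α : ℝ} (hα : 0 ≤ α) :
    ENNReal.ofReal (dist x y ^ α) = edist x y ^ α := by
  rw [edist_dist, ENNReal.ofReal_rpow_of_nonneg dist_nonneg hα]

/-- Morrey's estimate on a ball centred at one of the two points. -/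
theorem exists_edist_le_of_closedBall_subset (d : ℕ) (hp : 1 ≤ p) (hs : 0 < s - d / p)
    (M : NNReal) : ∃ C : NNReal, ∀ (K : Set (EuclideanSpace ℝ (Fin d)))
      (g : EuclideanSpace ℝ (Fin d) → ℝ) (S : ℝ≥0∞), LocallyIntegrableOn g K →
      HasOscillationBound s p M K g S → ∀ x y, closedBall x (dist x y) ⊆ K →
      IsLebesguePoint g x → IsLebesguePoint g y →
      edist (g x) (g y) ≤ C * edist x y ^ (s - d / p) * S := by
  obtain ⟨C, hC⟩ := exists_edist_isLebesguePoint_le d hp hs M one_pos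
  refine ⟨C, fun K g S hgl hg x y hxy hxL hyL => ?_⟩
  rcases eq_or_ne x y with rfl | hne
  · simp
  · rw [← ofReal_dist_rpow x y hs.le]
    exact hC K g S hgl hg _ hxy (isCompact_closedBall _ _) (convex_closedBall _ _) x x _
      (dist_pos.2 hne) Subset.rfl (by rw [one_mul]) x (mem_closedBall_self dist_nonneg) y
      (by rw [mem_closedBall, dist_comm]) hxL hyL

/-- The continuous representative is the continuous extension of `g` from its Lebesgue points. -/
theorem HasOscillationBound.exists_continuousOn_ae_eq (hp : 1 ≤ p) (hs : 0 < s - d / p)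
    (hK : IsOpen K) {M : NNReal} {g : EuclideanSpace ℝ (Fin d) → ℝ} {S : ℝ≥0∞} (hS : S ≠ ∞)
    (hgl : LocallyIntegrableOn g K) (hg : HasOscillationBound s p M K g S) :
    ∃ h : EuclideanSpace ℝ (Fin d) → ℝ, h =ᵐ[volume.restrict K] g ∧ ContinuousOn h K := by
  obtain ⟨C, hC⟩ := exists_edist_le_of_closedBall_subset d hp hs M
  have hae := ae_isLebesguePoint hK hgl
  set N : Set (EuclideanSpace ℝ (Fin d)) := K ∩ {x | x ∈ K → IsLebesguePoint g x} with hN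
  have hKN : K ⊆ closure N := by
    have h1 := hK.inter_closure (t := {x | x ∈ K → IsLebesguePoint g x})
    rw [(Measure.dense_of_ae hae).closure_eq, inter_univ] at h1
    exact h1
  have hlim : ∀ x ∈ K, ∃ l, Tendsto g (𝓝[N] x) (𝓝 l) := by
    intro x hx
    have : (𝓝[N] x).NeBot := mem_closure_iff_nhdsWithin_neBot.1 (hKN hx)
    obtain ⟨ε, hε, hεK⟩ := Metric.isOpen_iff.1 hK x hx
    refine cauchy_map_iff_exists_tendsto.1 (EMetric.cauchy_iff.2 ⟨NeBot.ne', fun t ht => ?_⟩)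
    have hcont : Tendsto (fun q : EuclideanSpace ℝ (Fin d) × EuclideanSpace ℝ (Fin d) =>
        C * edist q.1 q.2 ^ (s - d / p) * S) (𝓝 x ×ˢ 𝓝 x) (𝓝 0) := by
      have h1 : Continuous fun q : EuclideanSpace ℝ (Fin d) × EuclideanSpace ℝ (Fin d) =>
          C * edist q.1 q.2 ^ (s - d / p) * S :=
        (ENNReal.continuous_mul_const hS).comp ((ENNReal.continuous_const_mul ENNReal.coe_ne_top).comp
          (ENNReal.continuous_rpow_const.comp continuous_edist))
      rw [← nhds_prod_eq]
      have h2 := h1.tendsto (x, x)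
      simpa [hs] using h2
    obtain ⟨U, hU, hUt⟩ := Filter.eventually_prod_self_iff
      (r := fun y z => C * edist y z ^ (s - d / p) * S < t) |>.1 (hcont.eventually_lt_const ht)
    have hnear : U ∩ ball x (ε / 3) ∩ N ∈ 𝓝[N] x :=
      inter_mem (nhdsWithin_le_nhds (inter_mem hU (ball_mem_nhds _ (by positivity))))
        self_mem_nhdsWithin
    refine ⟨_, image_mem_map hnear, ?_⟩
    rintro _ ⟨y, ⟨⟨hyU, hyx⟩, hyN⟩, rfl⟩ _ ⟨z, ⟨⟨hzU, hzx⟩, hzN⟩, rfl⟩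
    refine (hC K g S hgl hg y z ?_ (hyN.2 hyN.1) (hzN.2 hzN.1)).trans_lt (hUt y hyU z hzU)
    intro w hw
    refine hεK ?_
    rw [mem_closedBall] at hw
    rw [mem_ball] at *
    linarith [dist_triangle w y x, dist_triangle_right y z x]
  refine ⟨extendFrom N g, ?_, continuousOn_extendFrom hKN hlim⟩
  refine (ae_restrict_iff' hK.measurableSet).2 ?_
  filter_upwards [hae] with x hx hxK
  obtain ⟨l, hl⟩ := hlim x hxK
  have hxl : l = g x := tendsto_nhds_unique (hl.mono_left (pure_le_nhdsWithin ⟨hxK, hx⟩))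
    (tendsto_pure_nhds g x)
  exact extendFrom_eq (hKN hxK) (hxl ▸ hl)

theorem IsWeakGradient.congr {g h : EuclideanSpace ℝ (Fin d) → ℝ}
    (hgh : h =ᵐ[volume.restrict K] g) {G : EuclideanSpace ℝ (Fin d) → EuclideanSpace ℝ (Fin d)}
    (hG : IsWeakGradient K g G) : IsWeakGradient K h G := by
  refine ⟨hG.1, fun φ h1 h2 h3 v => ?_⟩
  rw [← hG.2 φ h1 h2 h3 v]
  refine integral_congr_ae ?_
  filter_upwards [hgh] with x hx
  rw [hx]

theorem sobolevSeminorm_congr {g h : EuclideanSpace ℝ (Fin d) → ℝ}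
    (hgh : h =ᵐ[volume.restrict K] g) : sobolevSeminorm s p K h = sobolevSeminorm s p K g := by
  unfold sobolevSeminorm
  split_ifs
  · have h1 : ∀ G, IsWeakGradient K h G ↔ IsWeakGradient K g G := fun G =>
      ⟨fun hG => hG.congr hgh.symm, fun hG => hG.congr hgh⟩
    simp [gradientSeminorm, h1]
  · unfold gagliardoSeminorm
    congr 1
    refine lintegral_congr_ae ?_
    filter_upwards [hgh] with x hx
    refine lintegral_congr_ae ?_
    filter_upwards [hgh] with y hy
    rw [hx, hy]

end Representative

section OscillationDistance

variable {d : ℕ} {s p : ℝ} {K : Set (EuclideanSpace ℝ (Fin d))}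

/-- The largest possible difference of values at `x` and `y` of a continuous function of seminorm
`|·|_{W^{s,p}(K)}` one. It satisfies the triangle inequality, and a bound of it by a multiple of a
power of the distance amounts to a Sobolev inequality on `K`. Functions of infinite seminorm are left
out; one of seminorm zero contributes `∞` if its values at `x` and `y` differ, and zero otherwise. -/
noncomputable def oscillationDistance (s p : ℝ) (K : Set (EuclideanSpace ℝ (Fin d)))
    (x y : EuclideanSpace ℝ (Fin d)) : ℝ≥0∞ :=
  ⨆ (h : EuclideanSpace ℝ (Fin d) → ℝ) (_ : ContinuousOn h K) (_ : sobolevSeminorm s p K h ≠ ∞),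
    edist (h x) (h y) / sobolevSeminorm s p K h

theorem oscillationDistance_le {x y : EuclideanSpace ℝ (Fin d)} {C : ℝ≥0∞}
    (h : ∀ h : EuclideanSpace ℝ (Fin d) → ℝ, ContinuousOn h K → sobolevSeminorm s p K h ≠ ∞ →
      edist (h x) (h y) ≤ C * sobolevSeminorm s p K h) : oscillationDistance s p K x y ≤ C :=
  iSup_le fun f => iSup_le fun hf => iSup_le fun hS => ENNReal.div_le_of_le_mul (h f hf hS)

theorem edist_le_oscillationDistance_mul {x y : EuclideanSpace ℝ (Fin d)}
    (hfin : oscillationDistance s p K x y ≠ ∞) {h : EuclideanSpace ℝ (Fin d) → ℝ}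
    (hh : ContinuousOn h K) (hS : sobolevSeminorm s p K h ≠ ∞) :
    edist (h x) (h y) ≤ oscillationDistance s p K x y * sobolevSeminorm s p K h :=
  (ENNReal.div_le_iff_le_mul (Or.inr hfin) (Or.inl hS)).1
    (le_iSup_of_le h (le_iSup_of_le hh (le_iSup_of_le hS le_rfl)))

theorem oscillationDistance_comm (x y : EuclideanSpace ℝ (Fin d)) :
    oscillationDistance s p K x y = oscillationDistance s p K y x := by
  simp only [oscillationDistance, edist_comm]

theorem oscillationDistance_triangle (x y z : EuclideanSpace ℝ (Fin d)) :
    oscillationDistance s p K x z ≤ oscillationDistance s p K x y + oscillationDistance s p K y z := by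
  refine iSup_le fun h => iSup_le fun hh => iSup_le fun hS => ?_
  calc edist (h x) (h z) / sobolevSeminorm s p K h
      ≤ edist (h x) (h y) / sobolevSeminorm s p K h +
          edist (h y) (h z) / sobolevSeminorm s p K h := by
        rw [← ENNReal.add_div]
        gcongr
        exact edist_triangle _ _ _
    _ ≤ _ := by
        gcongr <;> exact le_iSup_of_le h (le_iSup_of_le hh (le_iSup_of_le hS le_rfl))

/-- A Hölder bound for the oscillation distance is a Sobolev inequality. -/
theorem sobolevInequality_of_oscillationDistance_le (hp : 1 ≤ p) (hs : 0 < s) (hs' : 0 < s - d / p)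
    (hK : IsOpen K) {C : NNReal}
    (hC : ∀ x ∈ K, ∀ y ∈ K, oscillationDistance s p K x y ≤ C * edist x y ^ (s - d / p)) :
    SobolevInequality s p K C := by
  intro g hg hS
  obtain ⟨M, hM⟩ := exists_hasOscillationBound d hp hs
  obtain ⟨h, hhg, hhc⟩ := (hM K g hK hg hS).exists_continuousOn_ae_eq hp hs' hK hS hg
  refine ⟨h, hhg, ?_⟩
  rw [← sobolevSeminorm_congr hhg] at hS ⊢
  refine iSup₂_le fun x hx => iSup₂_le fun y hy => iSup_le fun hxy => ?_
  have hfin : (C : ℝ≥0∞) * edist x y ^ (s - d / p) ≠ ∞ :=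
    ENNReal.mul_ne_top ENNReal.coe_ne_top (ENNReal.rpow_ne_top_of_nonneg hs'.le (edist_ne_top _ _))
  have h1 := edist_le_oscillationDistance_mul (ne_top_of_le_ne_top hfin (hC x hx y hy)) hhc hS
  refine ENNReal.div_le_of_le_mul ?_
  rw [← edist_eq_enorm_sub, edist_comm]
  refine h1.trans ((mul_le_mul_left (hC x hx y hy) _).trans (le_of_eq ?_))
  ring

theorem exists_oscillationDistance_le_of_closedBall_subset (d : ℕ) (hp : 1 ≤ p) (hs : 0 < s)
    (hs' : 0 < s - d / p) : ∃ C : NNReal, ∀ K : Set (EuclideanSpace ℝ (Fin d)), IsOpen K →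
      ∀ x y, closedBall x (dist x y) ⊆ K →
      oscillationDistance s p K x y ≤ C * edist x y ^ (s - d / p) := by
  obtain ⟨M, hM⟩ := exists_hasOscillationBound d hp hs
  obtain ⟨C, hC⟩ := exists_edist_le_of_closedBall_subset d hp hs' M
  refine ⟨C, fun K hK x y hxy => oscillationDistance_le fun h hh hS => ?_⟩
  have hloc := hh.locallyIntegrableOn hK.measurableSet (μ := volume)
  have hx : ContinuousAt h x := hh.continuousAt (hK.mem_nhds (hxy (mem_closedBall_self dist_nonneg)))
  have hy : ContinuousAt h y := hh.continuousAt
    (hK.mem_nhds (hxy (by rw [mem_closedBall, dist_comm])))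
  exact hC K h _ hloc (hM K h hK hloc hS) x y hxy (.of_continuousAt hx) (.of_continuousAt hy)

end OscillationDistance

/-! ### The Sobolev inequality on Lipschitz domains -/

section Cone

variable {d : ℕ}

/-- The cone with apex `x`, axis `e` (a unit vector), slope `L` and height `ρ`. -/
def truncatedCone (e : EuclideanSpace ℝ (Fin d)) (L ρ : ℝ) (x : EuclideanSpace ℝ (Fin d)) :
    Set (EuclideanSpace ℝ (Fin d)) :=
  {u | L * ‖(u - x) - inner ℝ e (u - x) • e‖ ≤ inner ℝ e (u - x) ∧ inner ℝ e (u - x) ≤ ρ}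

variable {e x : EuclideanSpace ℝ (Fin d)} {L ρ : ℝ}

theorem self_mem_truncatedCone (hρ : 0 ≤ ρ) : x ∈ truncatedCone e L ρ x := by
  simp [truncatedCone, hρ]

theorem truncatedCone_subset_closedBall (he : ‖e‖ = 1) (hL : 1 ≤ L) :
    truncatedCone e L ρ x ⊆ closedBall x (2 * ρ) := by
  rintro u ⟨h1, h2⟩
  rw [mem_closedBall, dist_eq_norm]
  set v := u - x
  have h3 : ‖v‖ ≤ ‖v - inner ℝ e v • e‖ + ‖inner ℝ e v • e‖ := by
    simpa using norm_add_le (v - inner ℝ e v • e) (inner ℝ e v • e)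
  have h4 : 0 ≤ inner ℝ e v := le_trans (by positivity) h1
  rw [norm_smul, he, mul_one, Real.norm_of_nonneg h4] at h3
  nlinarith [norm_nonneg (v - inner ℝ e v • e)]

theorem isCompact_truncatedCone (he : ‖e‖ = 1) (hL : 1 ≤ L) :
    IsCompact (truncatedCone e L ρ x) := by
  refine (isCompact_closedBall x (2 * ρ)).of_isClosed_subset ?_
    (truncatedCone_subset_closedBall he hL)
  have h1 : IsClosed {u : EuclideanSpace ℝ (Fin d) |
      L * ‖(u - x) - inner ℝ e (u - x) • e‖ ≤ inner ℝ e (u - x)} :=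
    isClosed_le (by fun_prop) (by fun_prop)
  have h2 : IsClosed {u : EuclideanSpace ℝ (Fin d) | inner ℝ e (u - x) ≤ ρ} :=
    isClosed_le (by fun_prop) (by fun_prop)
  exact h1.inter h2

theorem convex_truncatedCone (hL : 0 ≤ L) : Convex ℝ (truncatedCone e L ρ x) := by
  rintro u ⟨hu1, hu2⟩ v ⟨hv1, hv2⟩ a b ha hb hab
  have h1 : a • u + b • v - x = a • (u - x) + b • (v - x) := by
    have : x = (a + b) • x := by rw [hab, one_smul]
    nth_rw 1 [this]
    module
  set y := u - x
  set z := v - x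
  have h2 : inner ℝ e (a • y + b • z) = a * inner ℝ e y + b * inner ℝ e z := by
    rw [inner_add_right, real_inner_smul_right, real_inner_smul_right]
  suffices h : L * ‖a • y + b • z - (a * inner ℝ e y + b * inner ℝ e z) • e‖ ≤
      a * inner ℝ e y + b * inner ℝ e z ∧ a * inner ℝ e y + b * inner ℝ e z ≤ ρ by
    rw [← h2, ← h1] at h
    exact h
  constructor
  · have h3 : a • y + b • z - (a * inner ℝ e y + b * inner ℝ e z) • e =
        a • (y - inner ℝ e y • e) + b • (z - inner ℝ e z • e) := by module
    have h4 : ‖a • (y - inner ℝ e y • e) + b • (z - inner ℝ e z • e)‖ ≤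
        a * ‖y - inner ℝ e y • e‖ + b * ‖z - inner ℝ e z • e‖ := by
      refine (norm_add_le _ _).trans (le_of_eq ?_)
      rw [norm_smul, norm_smul, Real.norm_of_nonneg ha, Real.norm_of_nonneg hb]
    rw [h3]
    nlinarith [mul_le_mul_of_nonneg_left h4 hL, mul_le_mul_of_nonneg_left hu1 ha,
      mul_le_mul_of_nonneg_left hv1 hb]
  · calc a * inner ℝ e y + b * inner ℝ e z ≤ a * ρ + b * ρ := by gcongr
      _ = ρ := by rw [← add_mul, hab, one_mul]

/-- The factor `4 * L + 2` leaves room for the crude bound `2 * ‖w‖` for the norm of the component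
of a vector `w` orthogonal to the axis. -/
theorem closedBall_subset_truncatedCone (he : ‖e‖ = 1) (hL : 0 ≤ L) {t : ℝ}
    (ht : (4 * L + 2) * t = ρ) :
    closedBall (x + (ρ / 2) • e) t ⊆ truncatedCone e L ρ x := by
  intro u hu
  rw [mem_closedBall, dist_eq_norm] at hu
  set w := u - (x + (ρ / 2) • e) with hw
  have h1 : u - x = (ρ / 2) • e + w := by rw [hw]; module
  have h2 : |inner ℝ e w| ≤ ‖w‖ := by simpa [he] using abs_real_inner_le_norm e w
  have h3 : inner ℝ e (u - x) = ρ / 2 + inner ℝ e w := by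
    rw [h1, inner_add_right, real_inner_smul_right, real_inner_self_eq_norm_sq, he]; ring
  have h4 : u - x - inner ℝ e (u - x) • e = w - inner ℝ e w • e := by
    rw [h3, h1]; module
  have h5 : ‖w - inner ℝ e w • e‖ ≤ 2 * ‖w‖ := by
    refine (norm_sub_le _ _).trans ?_
    rw [norm_smul, he, mul_one, Real.norm_eq_abs]
    linarith
  obtain ⟨h6, h7⟩ := abs_le.1 h2
  refine ⟨?_, ?_⟩
  · rw [h4, h3]
    nlinarith [mul_le_mul_of_nonneg_left h5 hL]
  · rw [h3]
    nlinarith [norm_nonneg w, mul_nonneg hL ((norm_nonneg w).trans hu)]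

/-- Near a boundary point, any two points of a Lipschitz domain are the apices of two intersecting
cones inside the domain, of size comparable to the distance of the two points. -/
theorem HasLipschitzBoundary.exists_truncatedCone {K : Set (EuclideanSpace ℝ (Fin d))}
    (hK : HasLipschitzBoundary K) {x₀ : EuclideanSpace ℝ (Fin d)} (hx₀ : x₀ ∈ frontier K) :
    ∃ e : EuclideanSpace ℝ (Fin d), ‖e‖ = 1 ∧ ∃ L : ℝ, 1 ≤ L ∧ ∃ δ > 0,
      ∀ x ∈ K ∩ ball x₀ δ, ∀ y ∈ K ∩ ball x₀ δ,
        truncatedCone e L ((4 * L + 2) * dist x y) x ⊆ K ∧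
        (truncatedCone e L ((4 * L + 2) * dist x y) x ∩
          truncatedCone e L ((4 * L + 2) * dist x y) y).Nonempty := by
  obtain ⟨e, he, L₀, φ, hφ, r, hr, hKr⟩ := hK x₀ hx₀
  set L : ℝ := L₀ + 1 with hL
  have hL1 : 1 ≤ L := by simp [hL]
  -- for points within `δ` of `x₀`, the cones have height less than `(4 * L + 2) * (2 * δ)`, so that
  -- they reach at most twice as far from their apices, which keeps them in the ball of radius `r`
  refine ⟨e, he, L, hL1, r / (1 + 4 * (4 * L + 2)), by positivity, fun x hx y hy => ⟨?_, ?_⟩⟩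
  · intro u hu
    have hxr : dist x x₀ < r / (1 + 4 * (4 * L + 2)) := hx.2
    have hyr : dist y x₀ < r / (1 + 4 * (4 * L + 2)) := hy.2
    have hδ : r / (1 + 4 * (4 * L + 2)) * (1 + 4 * (4 * L + 2)) = r :=
      div_mul_cancel₀ _ (by positivity)
    set δ := r / (1 + 4 * (4 * L + 2))
    have hux := mem_closedBall.1 (truncatedCone_subset_closedBall he hL1 hu)
    have hball : ∀ z, dist z x₀ < r → (z ∈ K ↔ φ (z - inner ℝ e z • e) < inner ℝ e z) :=
      fun z hz => hKr z hz
    have hur : dist u x₀ < r := by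
      have h1 := dist_triangle u x x₀
      have h2 := mul_le_mul_of_nonneg_left (dist_triangle_right x y x₀)
        (by positivity : 0 ≤ 2 * (4 * L + 2))
      nlinarith
    have hxr' : dist x x₀ < r := by
      have := (dist_nonneg (x := x) (y := x₀)).trans_lt hxr
      nlinarith
    have hxK := (hball x hxr').1 hx.1
    rw [hball u hur]
    have h1 : φ (u - inner ℝ e u • e) - φ (x - inner ℝ e x • e) ≤
        L₀ * ‖u - x - inner ℝ e (u - x) • e‖ := by
      refine (le_abs_self _).trans ?_
      rw [← Real.dist_eq]
      refine (hφ.dist_le_mul _ _).trans (le_of_eq ?_)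
      rw [dist_eq_norm, inner_sub_right]
      congr 2
      module
    have h2 := hu.1
    have h3 : inner ℝ e (u - x) = inner ℝ e u - inner ℝ e x := inner_sub_right _ _ _
    rw [h3] at h1 h2
    nlinarith [norm_nonneg (u - x - (inner ℝ e u - inner ℝ e x) • e)]
  · refine ⟨x + (((4 * L + 2) * dist x y) / 2) • e,
      closedBall_subset_truncatedCone he (by linarith) rfl (mem_closedBall_self dist_nonneg),
      closedBall_subset_truncatedCone he (by linarith) rfl ?_⟩
    simp [mem_closedBall]

end Cone

section Global

variable {d : ℕ} {s p : ℝ} {K : Set (EuclideanSpace ℝ (Fin d))}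

/-- The Hölder bound for the oscillation distance near a point of the closure of the domain. -/
theorem HasLipschitzBoundary.exists_oscillationDistance_le (hp : 1 ≤ p) (hs : 0 < s)
    (hs' : 0 < s - d / p) (hK : IsOpen K) (hKL : HasLipschitzBoundary K)
    {x₀ : EuclideanSpace ℝ (Fin d)} (hx₀ : x₀ ∈ closure K) :
    ∃ δ > 0, ∃ C : NNReal, ∀ x ∈ K ∩ ball x₀ δ, ∀ y ∈ K ∩ ball x₀ δ,
      oscillationDistance s p K x y ≤ C * edist x y ^ (s - d / p) := by
  by_cases hx₀K : x₀ ∈ K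
  · obtain ⟨C, hC⟩ := exists_oscillationDistance_le_of_closedBall_subset d hp hs hs'
    obtain ⟨ε, hε, hεK⟩ := Metric.isOpen_iff.1 hK x₀ hx₀K
    refine ⟨ε / 3, by positivity, C, fun x hx y hy => hC K hK x y fun w hw => hεK ?_⟩
    have h1 := mem_closedBall.1 hw
    have h2 := mem_ball.1 hx.2
    have h3 := mem_ball.1 hy.2
    rw [mem_ball]
    linarith [dist_triangle w x x₀, dist_triangle_right x y x₀]
  · have hfr : x₀ ∈ frontier K := by
      rw [hK.frontier_eq]
      exact ⟨hx₀, hx₀K⟩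
    obtain ⟨e, he, L, hL, δ, hδ, hcone⟩ := hKL.exists_truncatedCone hfr
    have hη : (0 : ℝ) < (2 * (4 * L + 2))⁻¹ := by positivity
    obtain ⟨M, hM⟩ := exists_hasOscillationBound d hp hs
    obtain ⟨C, hC⟩ := exists_edist_isLebesguePoint_le d hp hs' M hη
    refine ⟨δ, hδ, (C + C) * Real.toNNReal ((2 * (4 * L + 2)) ^ (s - d / p)),
      fun x hx y hy => oscillationDistance_le fun h hh hS => ?_⟩
    rcases eq_or_ne x y with rfl | hxy
    · simp
    have hloc := hh.locallyIntegrableOn hK.measurableSet (μ := volume)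
    have hLeb : ∀ z ∈ K, IsLebesguePoint h z := fun z hz =>
      .of_continuousAt (hh.continuousAt (hK.mem_nhds hz))
    have hdist : 0 < dist x y := dist_pos.2 hxy
    set ρ := (4 * L + 2) * dist x y with hρ
    have hρ0 : 0 < ρ := by positivity
    -- in each of the two cones, the apex is compared with a common point
    have hside : ∀ z, truncatedCone e L ρ z ⊆ K → ∀ w ∈ truncatedCone e L ρ z,
        edist (h z) (h w) ≤
          C * ENNReal.ofReal ((2 * ρ) ^ (s - d / p)) * sobolevSeminorm s p K h := by
      intro z hz w hw
      have hzz : z ∈ truncatedCone e L ρ z := self_mem_truncatedCone hρ0.le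
      refine hC K h _ hloc (hM K h hK hloc hS) _ hz (isCompact_truncatedCone he hL)
        (convex_truncatedCone (by linarith)) z (z + (ρ / 2) • e) (2 * ρ) (by positivity)
        (truncatedCone_subset_closedBall he hL) ?_ z hzz w hw (hLeb z (hz hzz)) (hLeb w (hz hw))
      refine closedBall_subset_truncatedCone he (by linarith) ?_
      field_simp
    obtain ⟨hxK, w, hwx, hwy⟩ := hcone x hx y hy
    have hyK := (hcone y hy x hx).1
    rw [dist_comm y x] at hyK
    refine (edist_triangle_right _ _ (h w)).trans ((add_le_add (hside x hxK w hwx)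
      (hside y hyK w hwy)).trans (le_of_eq ?_))
    rw [hρ, ← mul_assoc, Real.mul_rpow (by positivity) dist_nonneg,
      ENNReal.ofReal_mul (by positivity), ofReal_dist_rpow x y hs'.le, ENNReal.coe_mul,
      ENNReal.coe_add]
    simp only [ENNReal.ofReal]
    ring

/-- A function of two variables that satisfies the triangle inequality, is finite, and is locally
bounded by a power of the distance near each point of a compact set, is globally so bounded. -/
theorem exists_le_mul_edist_rpow {X : Type*} [MetricSpace X] {D : X → X → ℝ≥0∞}
    (htri : ∀ x y z, D x z ≤ D x y + D y z) {K : Set X}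
    (hK : IsCompact (closure K)) {α : ℝ} (hα : 0 < α)
    (hloc : ∀ x₀ ∈ closure K, ∃ δ > 0, ∃ C : NNReal, ∀ x ∈ K ∩ ball x₀ δ, ∀ y ∈ K ∩ ball x₀ δ,
      D x y ≤ C * edist x y ^ α)
    (hfin : ∀ x ∈ K, ∀ y ∈ K, D x y ≠ ∞) :
    ∃ C : NNReal, ∀ x ∈ K, ∀ y ∈ K, D x y ≤ C * edist x y ^ α := by
  have hprod : IsCompact (closure K ×ˢ closure K) := hK.prod hK
  have key : ∃ C : NNReal, ∀ x ∈ K, ∀ y ∈ K, (x, y) ∈ closure K ×ˢ closure K →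
      D x y ≤ C * edist x y ^ α := by
    refine hprod.induction_on
      (p := fun V => ∃ C : NNReal, ∀ x ∈ K, ∀ y ∈ K, (x, y) ∈ V → D x y ≤ C * edist x y ^ α)
      ⟨0, fun _ _ _ _ h => h.elim⟩ ?_ ?_ ?_
    · rintro V W hVW ⟨C, hC⟩
      exact ⟨C, fun x hx y hy h => hC x hx y hy (hVW h)⟩
    · rintro V W ⟨C, hC⟩ ⟨C', hC'⟩
      refine ⟨max C C', fun x hx y hy h => ?_⟩
      rcases h with h | h
      · exact (hC x hx y hy h).trans (by gcongr; exact le_max_left _ _)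
      · exact (hC' x hx y hy h).trans (by gcongr; exact le_max_right _ _)
    · rintro ⟨x₀, y₀⟩ ⟨hx₀, hy₀⟩
      obtain ⟨δ₁, hδ₁, C₁, hC₁⟩ := hloc x₀ hx₀
      obtain ⟨δ₂, hδ₂, C₂, hC₂⟩ := hloc y₀ hy₀
      rcases eq_or_ne x₀ y₀ with rfl | hne
      · exact ⟨ball x₀ δ₁ ×ˢ ball x₀ δ₁, nhdsWithin_le_nhds
          (prod_mem_nhds (ball_mem_nhds _ hδ₁) (ball_mem_nhds _ hδ₁)), C₁,
          fun x hx y hy h => hC₁ x ⟨hx, h.1⟩ y ⟨hy, h.2⟩⟩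
      · obtain ⟨z, hz, hzK⟩ := mem_closure_iff.1 hx₀ _ isOpen_ball (mem_ball_self hδ₁)
        obtain ⟨w, hw, hwK⟩ := mem_closure_iff.1 hy₀ _ isOpen_ball (mem_ball_self hδ₂)
        -- distances are bounded below near `(x₀, y₀)`, so that it suffices to bound `D` there, by
        -- comparison with its value at `(z, w)`
        set κ := dist x₀ y₀ / 3 with hκ
        have hκ0 : 0 < κ := by have := dist_pos.2 hne; positivity
        set Q := C₁ * ENNReal.ofReal (2 * δ₁) ^ α + D z w + C₂ * ENNReal.ofReal (2 * δ₂) ^ α with hQ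
        have hκα : ENNReal.ofReal κ ^ α ≠ 0 := by
          simp [ENNReal.rpow_eq_zero_iff, hκ0, hα.not_gt]
        have hκt : ENNReal.ofReal κ ^ α ≠ ∞ :=
          ENNReal.rpow_ne_top_of_nonneg hα.le ENNReal.ofReal_ne_top
        have hQt : Q ≠ ∞ := by
          have h1 := hfin z hzK w hwK
          have h2 : ENNReal.ofReal (2 * δ₁) ^ α ≠ ∞ :=
            ENNReal.rpow_ne_top_of_nonneg hα.le ENNReal.ofReal_ne_top
          have h3 : ENNReal.ofReal (2 * δ₂) ^ α ≠ ∞ :=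
            ENNReal.rpow_ne_top_of_nonneg hα.le ENNReal.ofReal_ne_top
          finiteness
        refine ⟨ball x₀ (min δ₁ κ) ×ˢ ball y₀ (min δ₂ κ), nhdsWithin_le_nhds
          (prod_mem_nhds (ball_mem_nhds _ (lt_min hδ₁ hκ0)) (ball_mem_nhds _ (lt_min hδ₂ hκ0))),
          (Q / ENNReal.ofReal κ ^ α).toNNReal, fun x hx y hy h => ?_⟩
        rw [ENNReal.coe_toNNReal (ENNReal.div_ne_top hQt hκα)]
        have hx1 : dist x x₀ < min δ₁ κ := h.1
        have hy1 : dist y y₀ < min δ₂ κ := h.2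
        rw [lt_min_iff] at hx1 hy1
        have hxy : ENNReal.ofReal κ ≤ edist x y := by
          rw [edist_dist]
          apply ENNReal.ofReal_le_ofReal
          have h1 := dist_triangle x₀ x y₀
          have h2 := dist_triangle x y y₀
          rw [dist_comm x₀ x] at h1
          linarith
        have hdist : ∀ {u v c : X} {δ : ℝ}, dist u c < δ → dist v c < δ →
            edist u v ≤ ENNReal.ofReal (2 * δ) := by
          intro u v c δ h1 h2
          rw [edist_dist]
          apply ENNReal.ofReal_le_ofReal
          linarith [dist_triangle_right u v c]
        calc D x y ≤ D x z + D z w + D w y :=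
              (htri x w y).trans (by gcongr; exact htri x z w)
          _ ≤ Q := by
              rw [hQ]
              gcongr
              · exact (hC₁ x ⟨hx, hx1.1⟩ z ⟨hzK, hz⟩).trans (by gcongr; exact hdist hx1.1 hz)
              · exact (hC₂ w ⟨hwK, hw⟩ y ⟨hy, hy1.1⟩).trans (by gcongr; exact hdist hw hy1.1)
          _ = Q / ENNReal.ofReal κ ^ α * ENNReal.ofReal κ ^ α :=
              (ENNReal.div_mul_cancel hκα hκt).symm
          _ ≤ _ := by gcongr
  obtain ⟨C, hC⟩ := key
  exact ⟨C, fun x hx y hy => hC x hx y hy ⟨subset_closure hx, subset_closure hy⟩⟩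

theorem oscillationDistance_ne_top_of_isPreconnected (hp : 1 ≤ p) (hs : 0 < s)
    (hs' : 0 < s - d / p) (hK : IsOpen K) (hKc : IsPreconnected K)
    {x y : EuclideanSpace ℝ (Fin d)} (hx : x ∈ K) (hy : y ∈ K) :
    oscillationDistance s p K x y ≠ ∞ := by
  obtain ⟨C, hC⟩ := exists_oscillationDistance_le_of_closedBall_subset d hp hs hs'
  refine hKc.induction₂ (fun x y => oscillationDistance s p K x y ≠ ∞) ?_ ?_ ?_ hx hy
  · intro x hx
    obtain ⟨ε, hε, hεK⟩ := Metric.isOpen_iff.1 hK x hx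
    filter_upwards [nhdsWithin_le_nhds (ball_mem_nhds x hε)] with y hy
    refine ne_top_of_le_ne_top ?_ (hC K hK x y ((closedBall_subset_ball (mem_ball'.1 hy)).trans hεK))
    exact ENNReal.mul_ne_top ENNReal.coe_ne_top
      (ENNReal.rpow_ne_top_of_nonneg hs'.le (edist_ne_top _ _))
  · intro x y z _ _ _ hxy hyz
    exact ne_top_of_le_ne_top (ENNReal.add_ne_top.2 ⟨hxy, hyz⟩) (oscillationDistance_triangle x y z)
  · intro x y _ _ h
    rwa [oscillationDistance_comm]

/-- For `s < 1`, the seminorm also compares values in different connected components. -/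
theorem oscillationDistance_ne_top_of_lt_one (hp : 1 ≤ p) (hs : 0 < s) (hs1 : s < 1)
    (hs' : 0 < s - d / p) (hK : IsOpen K) {x y : EuclideanSpace ℝ (Fin d)} (hx : x ∈ K)
    (hy : y ∈ K) : oscillationDistance s p K x y ≠ ∞ := by
  have hp0 : 0 < p := by linarith
  obtain ⟨C, hC⟩ := exists_oscillationDistance_le_of_closedBall_subset d hp hs hs'
  obtain ⟨ε₁, hε₁, hx'⟩ := Metric.nhds_basis_closedBall.mem_iff.1 (hK.mem_nhds hx)
  obtain ⟨ε₂, hε₂, hy'⟩ := Metric.nhds_basis_closedBall.mem_iff.1 (hK.mem_nhds hy)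
  set r := min ε₁ ε₂ with hr
  have hr0 : 0 < r := lt_min hε₁ hε₂
  set A := closedBall x r with hA
  set B := closedBall y r with hB
  have hAK : A ⊆ K := (closedBall_subset_closedBall (min_le_left _ _)).trans hx'
  have hBK : B ⊆ K := (closedBall_subset_closedBall (min_le_right _ _)).trans hy'
  set C₀ : ℝ≥0∞ := C * ENNReal.ofReal r ^ (s - d / p) with hC₀
  have hC₀t : C₀ ≠ ∞ := ENNReal.mul_ne_top ENNReal.coe_ne_top
    (ENNReal.rpow_ne_top_of_nonneg hs'.le ENNReal.ofReal_ne_top)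
  have hnear : ∀ z, closedBall z r ⊆ K → ∀ u ∈ closedBall z r,
      oscillationDistance s p K z u ≤ C₀ := by
    intro z hz u hu
    refine (hC K hK z u ((closedBall_subset_closedBall (mem_closedBall'.1 hu)).trans hz)).trans ?_
    rw [hC₀]
    gcongr
    rw [edist_dist]
    exact ENNReal.ofReal_le_ofReal (mem_closedBall'.1 hu)
  set D := ENNReal.ofReal (dist x y + 2 * r) with hD
  have hDdist : ∀ u ∈ A, ∀ v ∈ B, ‖u - v‖ₑ ≤ D := by
    intro u hu v hv
    rw [← edist_eq_enorm_sub, edist_dist]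
    apply ENNReal.ofReal_le_ofReal
    have h1 := mem_closedBall.1 hu
    have h2 := mem_closedBall'.1 hv
    linarith [dist_triangle4 u x y v]
  have hA0 : volume A ≠ 0 := (measure_closedBall_pos _ _ hr0).ne'
  have hB0 : volume B ≠ 0 := (measure_closedBall_pos _ _ hr0).ne'
  have hAt : volume A ≠ ∞ := measure_closedBall_lt_top.ne
  have hBt : volume B ≠ ∞ := measure_closedBall_lt_top.ne
  -- the values at `x` and `y` are compared with all values on the balls `A` and `B`, and the
  -- Gagliardo seminorm bounds the average over `A × B` of `‖h u - h v‖ₑ ^ p`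
  set Q : ℝ≥0∞ := 2 ^ (p - 1) * ((2 * C₀) ^ p +
    (volume A)⁻¹ * ((volume B)⁻¹ * D ^ ((d : ℝ) + s * p))) with hQ
  have hQt : Q ≠ ∞ := by
    have h1 : D ^ ((d : ℝ) + s * p) ≠ ∞ :=
      ENNReal.rpow_ne_top_of_nonneg (by positivity) ENNReal.ofReal_ne_top
    have h2 : (2 * C₀) ^ p ≠ ∞ := ENNReal.rpow_ne_top_of_nonneg hp0.le (by finiteness)
    have h3 : (2 : ℝ≥0∞) ^ (p - 1) ≠ ∞ := ENNReal.rpow_ne_top_of_nonneg (by linarith) (by simp)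
    have h4 := ENNReal.inv_ne_top.2 hA0
    have h5 := ENNReal.inv_ne_top.2 hB0
    finiteness
  refine ne_top_of_le_ne_top (ENNReal.rpow_ne_top_of_nonneg (by positivity : 0 ≤ 1 / p) hQt)
    (oscillationDistance_le fun h hh hS => ?_)
  set S := sobolevSeminorm s p K h with hSdef
  have hSg : S = gagliardoSeminorm s p K h := by rw [hSdef, sobolevSeminorm, if_neg hs1.ne]
  have hpoint : ∀ u ∈ A, ∀ v ∈ B, edist (h x) (h y) ^ p ≤
      2 ^ (p - 1) * ((2 * C₀ * S) ^ p + ‖h u - h v‖ₑ ^ p) := by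
    intro u hu v hv
    have hval : ∀ z, closedBall z r ⊆ K → ∀ u ∈ closedBall z r, edist (h z) (h u) ≤ C₀ * S := by
      intro z hz u hu
      have h1 := hnear z hz u hu
      refine (edist_le_oscillationDistance_mul (ne_top_of_le_ne_top hC₀t h1) hh hS).trans ?_
      gcongr
    have h1 : edist (h x) (h y) ≤ 2 * C₀ * S + ‖h u - h v‖ₑ := by
      rw [← edist_eq_enorm_sub]
      calc edist (h x) (h y) ≤ edist (h x) (h u) + edist (h u) (h v) + edist (h v) (h y) :=
            edist_triangle4 _ _ _ _
        _ ≤ C₀ * S + edist (h u) (h v) + C₀ * S := by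
            gcongr
            · exact hval x hAK u hu
            · rw [edist_comm]; exact hval y hBK v hv
        _ = _ := by ring
    exact (ENNReal.rpow_le_rpow h1 hp0.le).trans (ENNReal.rpow_add_le_mul_rpow_add_rpow _ _ hp)
  have hint : edist (h x) (h y) ^ p * volume B * volume A ≤ 2 ^ (p - 1) *
      ((2 * C₀ * S) ^ p * volume B * volume A + D ^ ((d : ℝ) + s * p) * S ^ p) := by
    have h2t : (2 : ℝ≥0∞) ^ (p - 1) ≠ ∞ := ENNReal.rpow_ne_top_of_nonneg (by linarith) (by simp)
    calc edist (h x) (h y) ^ p * volume B * volume A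
        = ∫⁻ u in A, ∫⁻ v in B, edist (h x) (h y) ^ p := by simp
      _ ≤ ∫⁻ u in A, ∫⁻ v in B, 2 ^ (p - 1) * ((2 * C₀ * S) ^ p + ‖h u - h v‖ₑ ^ p) :=
          setLIntegral_mono' measurableSet_closedBall fun u hu =>
            setLIntegral_mono' measurableSet_closedBall fun v hv => hpoint u hu v hv
      _ = 2 ^ (p - 1) * ((2 * C₀ * S) ^ p * volume B * volume A +
            ∫⁻ u in A, ∫⁻ v in B, ‖h u - h v‖ₑ ^ p) := by
          simp_rw [lintegral_const_mul' _ _ h2t, lintegral_add_left measurable_const,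
            setLIntegral_const]
      _ ≤ _ := by
          gcongr
          rw [hSg]
          exact lintegral_lintegral_le_gagliardoSeminorm hp hs h measurableSet_closedBall
            measurableSet_closedBall hAK hBK hDdist ENNReal.ofReal_ne_top
  rw [← ENNReal.rpow_le_rpow_iff hp0, ENNReal.mul_rpow_of_nonneg _ _ hp0.le, ← ENNReal.rpow_mul,
    one_div_mul_cancel hp0.ne', ENNReal.rpow_one]
  rw [← ENNReal.mul_le_mul_iff_left hB0 hBt, ← ENNReal.mul_le_mul_iff_left hA0 hAt]
  refine hint.trans (le_of_eq ?_)
  rw [hQ, ENNReal.mul_rpow_of_nonneg _ S hp0.le]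
  have hcancel : (volume A)⁻¹ * ((volume B)⁻¹ * D ^ ((d : ℝ) + s * p)) * volume B * volume A =
      D ^ ((d : ℝ) + s * p) := by
    calc _ = ((volume A)⁻¹ * volume A) * ((volume B)⁻¹ * volume B) * D ^ ((d : ℝ) + s * p) := by
          ring
      _ = _ := by
          rw [ENNReal.inv_mul_cancel hA0 hAt, ENNReal.inv_mul_cancel hB0 hBt, one_mul, one_mul]
  conv_lhs => rw [← hcancel]
  ring

/-- The Sobolev inequality on Lipschitz domains. -/
theorem sobolevConstant_lt_top (hp : 1 ≤ p) (hs : (d : ℝ) / p < s) (hK : IsOpen K)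
    (hKL : HasLipschitzBoundary K) (hKb : Bornology.IsBounded K ∨ K = univ)
    (hKc : s < 1 ∨ IsPreconnected K) : sobolevConstant s p K < ∞ := by
  have hs' : 0 < s - d / p := sub_pos.2 hs
  have hs0 : 0 < s := lt_of_le_of_lt (by positivity) hs
  suffices h : ∃ C : NNReal, ∀ x ∈ K, ∀ y ∈ K,
      oscillationDistance s p K x y ≤ C * edist x y ^ (s - d / p) by
    obtain ⟨C, hC⟩ := h
    exact (sInf_le (sobolevInequality_of_oscillationDistance_le hp hs0 hs' hK hC)).trans_lt
      ENNReal.coe_lt_top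
  rcases hKb with hKb | rfl
  · refine exists_le_mul_edist_rpow oscillationDistance_triangle
      hKb.isCompact_closure hs'
      (fun x₀ hx₀ => hKL.exists_oscillationDistance_le hp hs0 hs' hK hx₀) fun x hx y hy => ?_
    rcases hKc with h | h
    · exact oscillationDistance_ne_top_of_lt_one hp hs0 h hs' hK hx hy
    · exact oscillationDistance_ne_top_of_isPreconnected hp hs0 hs' hK h hx hy
  · obtain ⟨C, hC⟩ := exists_oscillationDistance_le_of_closedBall_subset d hp hs0 hs'
    exact ⟨C, fun x _ y _ => hC univ isOpen_univ x y (subset_univ _)⟩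

end Global

/-! ### The best constant -/

section BestConstant

variable {d : ℕ} {s p α : ℝ} {K : Set (EuclideanSpace ℝ (Fin d))}

theorem edist_le_holderSeminorm_mul {h : EuclideanSpace ℝ (Fin d) → ℝ} (hα : 0 ≤ α)
    {x y : EuclideanSpace ℝ (Fin d)} (hx : x ∈ K) (hy : y ∈ K) :
    edist (h x) (h y) ≤ holderSeminorm α K h * edist x y ^ α := by
  rcases eq_or_ne x y with rfl | hxy
  · simp
  have h0 : edist x y ^ α ≠ 0 := by simp [ENNReal.rpow_eq_zero_iff, hxy, edist_ne_top]
  have ht : edist x y ^ α ≠ ∞ := ENNReal.rpow_ne_top_of_nonneg hα (edist_ne_top _ _)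
  rw [← ENNReal.div_le_iff_le_mul (Or.inl h0) (Or.inl ht), edist_comm (h x), edist_eq_enorm_sub]
  exact le_iSup_of_le x (le_iSup_of_le hx (le_iSup_of_le y (le_iSup_of_le hy
    (le_iSup_of_le hxy le_rfl))))

theorem continuousOn_of_holderSeminorm_ne_top {h : EuclideanSpace ℝ (Fin d) → ℝ} (hα : 0 < α)
    (hh : holderSeminorm α K h ≠ ∞) : ContinuousOn h K := by
  have h1 : HolderOnWith (holderSeminorm α K h).toNNReal α.toNNReal h K := by
    intro x hx y hy
    rw [ENNReal.coe_toNNReal hh, Real.coe_toNNReal _ hα.le]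
    exact edist_le_holderSeminorm_mul hα.le hx hy
  exact h1.continuousOn (by simpa using hα)

/-- The best constant is attained, and a continuous function is its own Hölder representative. -/
theorem holderSeminorm_le_sobolevConstant_mul (hs : 0 < s - d / p) (hK : IsOpen K)
    (hC : sobolevConstant s p K < ∞) {h : EuclideanSpace ℝ (Fin d) → ℝ} (hh : ContinuousOn h K)
    (hS : sobolevSeminorm s p K h ≠ ∞) :
    holderSeminorm (s - d / p) K h ≤ sobolevConstant s p K * sobolevSeminorm s p K h := by
  have key : ∀ t, sobolevConstant s p K < t →
      holderSeminorm (s - d / p) K h ≤ t * sobolevSeminorm s p K h := by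
    intro t ht
    obtain ⟨C, hCmem, hCt⟩ := sInf_lt_iff.1 ht
    obtain ⟨h', hae, hle⟩ := hCmem h (hh.locallyIntegrableOn hK.measurableSet) hS
    have hne : holderSeminorm (s - d / p) K h' ≠ ∞ :=
      ne_top_of_le_ne_top (ENNReal.mul_ne_top hCt.ne_top hS) hle
    have heq : EqOn h' h K :=
      Measure.eqOn_open_of_ae_eq hae hK (continuousOn_of_holderSeminorm_ne_top hs hne) hh
    have : holderSeminorm (s - d / p) K h = holderSeminorm (s - d / p) K h' := by
      simp only [holderSeminorm]
      refine iSup_congr fun x => iSup_congr fun hx => iSup_congr fun y => iSup_congr fun hy => ?_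
      rw [heq hx, heq hy]
    rw [this]
    exact hle.trans (by gcongr)
  have hcont : Tendsto (fun t : ℝ≥0∞ => t * sobolevSeminorm s p K h) (𝓝[>] sobolevConstant s p K)
      (𝓝 (sobolevConstant s p K * sobolevSeminorm s p K h)) :=
    ((ENNReal.continuous_mul_const hS).tendsto _).mono_left nhdsWithin_le_nhds
  have : (𝓝[>] sobolevConstant s p K).NeBot := nhdsGT_neBot_of_exists_gt ⟨∞, hC⟩
  exact ge_of_tendsto hcont (eventually_nhdsWithin_of_forall key)

/-- For a compactly supported `C¹` function, the classical gradient is a weak gradient. -/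
theorem isWeakGradient_of_contDiff {φ : EuclideanSpace ℝ (Fin d) → ℝ} (hφ : ContDiff ℝ 1 φ)
    (hφc : HasCompactSupport φ) (hφK : tsupport φ ⊆ K) :
    IsWeakGradient K φ fun x => (InnerProductSpace.toDual ℝ _).symm (fderiv ℝ φ x) := by
  have hφ' : Continuous (fderiv ℝ φ) := hφ.continuous_fderiv one_ne_zero
  have hG : Continuous fun x =>
      (InnerProductSpace.toDual ℝ (EuclideanSpace ℝ (Fin d))).symm (fderiv ℝ φ x) :=
    (LinearIsometryEquiv.continuous _).comp hφ'
  refine ⟨hG.locallyIntegrable.locallyIntegrableOn K, fun ψ hψ hψc _ v => ?_⟩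
  have hψ' : Continuous (fderiv ℝ ψ) := hψ.continuous_fderiv (by simp)
  have h1 := integral_mul_fderiv_eq_neg_fderiv_mul_of_integrable (μ := volume) (f := φ) (g := ψ)
    (v := v)
    (((hφ'.clm_apply continuous_const).mul hψ.continuous).integrable_of_hasCompactSupport
      hψc.mul_left)
    ((hφ.continuous.mul (hψ'.clm_apply continuous_const)).integrable_of_hasCompactSupport
      hφc.mul_right)
    ((hφ.continuous.mul hψ.continuous).integrable_of_hasCompactSupport hφc.mul_right)
    (fun x _ => hφ.differentiable one_ne_zero x) (fun x _ => hψ.differentiable (by simp) x)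
  rw [setIntegral_eq_integral_of_forall_compl_eq_zero,
    setIntegral_eq_integral_of_forall_compl_eq_zero, h1]
  · congr 2
    ext x
    rw [InnerProductSpace.toDual_symm_apply, mul_comm]
  · intro x hx
    have : fderiv ℝ φ x = 0 := image_eq_zero_of_notMem_tsupport fun h =>
      hx (hφK (tsupport_fderiv_subset ℝ h))
    simp [this]
  · intro x hx
    have : φ x = 0 := image_eq_zero_of_notMem_tsupport fun h => hx (hφK h)
    simp [this]

/-- A bump function is not constant, so that the best constant does not vanish. -/
theorem sobolevConstant_one_ne_zero (hd : 0 < d) (hs : 0 < 1 - d / p) (hK : IsOpen K)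
    (hKne : K.Nonempty) : sobolevConstant 1 p K ≠ 0 := by
  intro h0
  obtain ⟨x₀, hx₀⟩ := hKne
  obtain ⟨ε, hε, hεK⟩ := Metric.nhds_basis_closedBall.mem_iff.1 (hK.mem_nhds hx₀)
  let φ : ContDiffBump x₀ := ⟨ε / 4, ε / 2, by positivity, by linarith⟩
  have hφK : tsupport φ ⊆ K := by
    rw [φ.tsupport_eq]
    exact (closedBall_subset_closedBall (by simp only [φ]; linarith)).trans hεK
  have hφ1 : ContDiff ℝ 1 φ := φ.contDiff (n := 1)
  have hS : sobolevSeminorm 1 p K φ ≠ ∞ := by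
    rw [sobolevSeminorm, if_pos rfl]
    have hG := isWeakGradient_of_contDiff hφ1 φ.hasCompactSupport hφK
    refine ne_top_of_le_ne_top ?_ (iInf₂_le _ hG)
    have hGc : Continuous fun x =>
        (InnerProductSpace.toDual ℝ (EuclideanSpace ℝ (Fin d))).symm (fderiv ℝ φ x) :=
      (LinearIsometryEquiv.continuous _).comp (hφ1.continuous_fderiv one_ne_zero)
    have hGs : HasCompactSupport fun x =>
        (InnerProductSpace.toDual ℝ (EuclideanSpace ℝ (Fin d))).symm (fderiv ℝ φ x) :=
      (φ.hasCompactSupport.fderiv ℝ).comp_left (map_zero _)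
    exact ((hGc.memLp_of_hasCompactSupport hGs).restrict K).eLpNorm_ne_top
  have hle := holderSeminorm_le_sobolevConstant_mul hs hK (by simp [h0])
    φ.continuous.continuousOn hS
  rw [h0, zero_mul] at hle
  set y := x₀ + ε • EuclideanSpace.single (⟨0, hd⟩ : Fin d) (1 : ℝ) with hy
  have hyd : dist y x₀ = ε := by
    simp [hy, dist_eq_norm, norm_smul, abs_of_pos hε]
  have hyK : y ∈ K := hεK (mem_closedBall.2 hyd.le)
  have h1 : φ x₀ = 1 := φ.one_of_mem_closedBall (mem_closedBall_self φ.rIn_pos.le)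
  have h2 : φ y = 0 := φ.zero_of_le_dist (by rw [hyd]; simp only [φ]; linarith)
  have h3 := (edist_le_holderSeminorm_mul hs.le hx₀ hyK).trans (mul_le_mul_left hle _)
  rw [zero_mul, h1, h2, nonpos_iff_eq_zero, edist_eq_zero] at h3
  exact one_ne_zero h3

end BestConstant

/-! ### Total variation distance of posteriors -/

section Posterior

variable {X Θ : Type*} [MeasurableSpace Θ] {π : Measure Θ} {f : X → Θ → ℝ}

theorem ofReal_le_ofReal_add_edist (a b : ℝ) :
    ENNReal.ofReal a ≤ ENNReal.ofReal b + edist a b := by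
  rw [edist_dist, Real.dist_eq]
  refine (ENNReal.ofReal_le_ofReal ?_).trans ENNReal.ofReal_add_le
  linarith [le_abs_self (a - b)]

theorem setLIntegral_ofReal_le_add (hf : ∀ x, Measurable (f x)) (A : Set Θ) (x y : X) :
    ∫⁻ θ in A, ENNReal.ofReal (f x θ) ∂π ≤
      ∫⁻ θ in A, ENNReal.ofReal (f y θ) ∂π + ∫⁻ θ in A, edist (f x θ) (f y θ) ∂π := by
  rw [← lintegral_add_left (hf y).ennreal_ofReal]
  exact lintegral_mono fun θ => ofReal_le_ofReal_add_edist _ _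

theorem abs_div_sub_div_le {a a' b b' : ℝ} (ha : 0 < a + a') (hb : 0 < b + b') (hb0 : 0 ≤ b)
    (hb0' : 0 ≤ b') :
    |a / (a + a') - b / (b + b')| ≤ (|a - b| + |a' - b'|) / (a + a') := by
  have h1 : a / (a + a') - b / (b + b') = ((a - b) * b' - b * (a' - b')) / ((a + a') * (b + b')) := by
    field_simp
    ring
  rw [h1, abs_div, abs_of_pos (mul_pos ha hb), div_le_div_iff₀ (mul_pos ha hb) ha]
  have h2 : |(a - b) * b' - b * (a' - b')| ≤ (|a - b| + |a' - b'|) * (b + b') := by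
    refine (abs_sub _ _).trans ?_
    rw [abs_mul, abs_mul, abs_of_nonneg hb0, abs_of_nonneg hb0']
    nlinarith [abs_nonneg (a - b), abs_nonneg (a' - b')]
  calc _ ≤ (|a - b| + |a' - b'|) * (b + b') * (a + a') := by gcongr
    _ = _ := by ring

/-- The normalization of the densities costs nothing: the mass that the normalized densities
exchange within `B` is also accounted for on the complement of `B`. -/
theorem tvDistance_bayesPosterior_le (hf : ∀ x, Measurable (f x)) {x y : X}
    (hx0 : marginalDensity π f x ≠ 0) (hxt : marginalDensity π f x ≠ ∞)
    (hy0 : marginalDensity π f y ≠ 0) (hyt : marginalDensity π f y ≠ ∞) :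
    tvDistance (bayesPosterior π f x) (bayesPosterior π f y) ≤
      (∫⁻ θ, edist (f x θ) (f y θ) ∂π) / marginalDensity π f x := by
  by_cases hΔ : ∫⁻ θ, edist (f x θ) (f y θ) ∂π = ∞
  · rw [hΔ, ENNReal.top_div_of_ne_top hxt]; exact le_top
  refine iSup₂_le fun B hB => ?_
  set m : X → Set Θ → ℝ≥0∞ := fun z A => ∫⁻ θ in A, ENNReal.ofReal (f z θ) ∂π with hm
  set e : Set Θ → ℝ≥0∞ := fun A => ∫⁻ θ in A, edist (f x θ) (f y θ) ∂π with he
  have hmadd : ∀ z, marginalDensity π f z = m z B + m z Bᶜ := fun z =>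
    (lintegral_add_compl _ hB).symm
  have headd : ∫⁻ θ, edist (f x θ) (f y θ) ∂π = e B + e Bᶜ := (lintegral_add_compl _ hB).symm
  have hxm := hmadd x
  have hym := hmadd y
  have het : e B ≠ ∞ ∧ e Bᶜ ≠ ∞ := by rwa [headd, ← ne_eq, ENNReal.add_ne_top] at hΔ
  have hxt' : m x B ≠ ∞ ∧ m x Bᶜ ≠ ∞ := by rwa [hxm, ENNReal.add_ne_top] at hxt
  have hyt' : m y B ≠ ∞ ∧ m y Bᶜ ≠ ∞ := by rwa [hym, ENNReal.add_ne_top] at hyt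
  have hreal : ∀ z, marginalDensity π f z ≠ ∞ → m z B ≠ ∞ → m z Bᶜ ≠ ∞ →
      (bayesPosterior π f z).real B = (m z B).toReal / ((m z B).toReal + (m z Bᶜ).toReal) := by
    intro z hz h1 h2
    rw [← ENNReal.toReal_add h1 h2, ← hmadd z, measureReal_def, bayesPosterior,
      Measure.smul_apply, withDensity_apply _ hB, smul_eq_mul, ENNReal.toReal_mul,
      ENNReal.toReal_inv, div_eq_inv_mul]
  have hpos : ∀ z, marginalDensity π f z ≠ 0 → marginalDensity π f z ≠ ∞ → m z B ≠ ∞ → m z Bᶜ ≠ ∞ →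
      0 < (m z B).toReal + (m z Bᶜ).toReal := by
    intro z h0 ht h1 h2
    rw [← ENNReal.toReal_add h1 h2, ← hmadd z]
    exact ENNReal.toReal_pos h0 ht
  have hdiff : ∀ A, m x A ≠ ∞ → m y A ≠ ∞ → e A ≠ ∞ →
      |(m x A).toReal - (m y A).toReal| ≤ (e A).toReal := by
    intro A h1 h2 h3
    have h4 : m x A ≤ m y A + e A := setLIntegral_ofReal_le_add hf A x y
    have h5 : m y A ≤ m x A + e A := by
      simpa only [he, edist_comm] using setLIntegral_ofReal_le_add (π := π) hf A y x
    have h6 := ENNReal.toReal_mono (ENNReal.add_ne_top.2 ⟨h2, h3⟩) h4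
    have h7 := ENNReal.toReal_mono (ENNReal.add_ne_top.2 ⟨h1, h3⟩) h5
    rw [ENNReal.toReal_add h2 h3] at h6
    rw [ENNReal.toReal_add h1 h3] at h7
    exact abs_sub_le_iff.2 ⟨by linarith, by linarith⟩
  have hxpos := hpos x hx0 hxt hxt'.1 hxt'.2
  have hypos := hpos y hy0 hyt hyt'.1 hyt'.2
  rw [hreal x hxt hxt'.1 hxt'.2, hreal y hyt hyt'.1 hyt'.2,
    ENNReal.ofReal_le_iff_le_toReal (ENNReal.div_ne_top hΔ hx0), ENNReal.toReal_div, headd, hxm,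
    ENNReal.toReal_add het.1 het.2, ENNReal.toReal_add hxt'.1 hxt'.2]
  refine (abs_div_sub_div_le hxpos hypos ENNReal.toReal_nonneg ENNReal.toReal_nonneg).trans ?_
  gcongr
  · exact hdiff B hxt'.1 hyt'.1 het.1
  · exact hdiff Bᶜ hxt'.2 hyt'.2 het.2

end Posterior

/-! ### Families of densities of finite average seminorm -/

section FamilyOfDensities

variable {d : ℕ} {s p : ℝ} {K X : Set (EuclideanSpace ℝ (Fin d))} {Θ : Type*} [MeasurableSpace Θ]
  {π : Measure Θ} {f : X → Θ → ℝ}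

theorem extend_val_apply (g : X → ℝ) {x : EuclideanSpace ℝ (Fin d)} (hx : x ∈ X) :
    Function.extend Subtype.val g 0 x = g ⟨x, hx⟩ :=
  Subtype.val_injective.extend_apply g 0 ⟨x, hx⟩

theorem measurable_gagliardoSeminorm_extend (hK : MeasurableSet K) (hKX : K ⊆ X)
    (hf : Measurable fun q : X × Θ => f q.1 q.2) :
    Measurable fun θ =>
      gagliardoSeminorm s p K (Function.extend Subtype.val (fun x : X => f x θ) 0) := by
  classical
  set F : EuclideanSpace ℝ (Fin d) × Θ → ℝ :=
    fun q => if h : q.1 ∈ K then f ⟨q.1, hKX h⟩ q.2 else 0 with hF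
  have hFm : Measurable F := by
    refine Measurable.dite (f := fun q : {q : EuclideanSpace ℝ (Fin d) × Θ | q.1 ∈ K} =>
      f ⟨q.1.1, hKX q.2⟩ q.1.2) (g := fun _ => 0) ?_ measurable_const (measurable_fst hK)
    refine hf.comp (Measurable.prodMk (Measurable.subtype_mk ?_) ?_)
    · exact measurable_fst.comp measurable_subtype_coe
    · exact measurable_snd.comp measurable_subtype_coe
  have hFf : ∀ θ, ∀ x ∈ K, Function.extend Subtype.val (fun x : X => f x θ) 0 x = F (x, θ) := by
    intro θ x hx
    rw [extend_val_apply _ (hKX hx)]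
    simp [hF, hx]
  have heq : ∀ θ, gagliardoSeminorm s p K (Function.extend Subtype.val (fun x : X => f x θ) 0) =
      gagliardoSeminorm s p K fun x => F (x, θ) := by
    intro θ
    unfold gagliardoSeminorm
    congr 1
    refine setLIntegral_congr_fun hK fun x hx => setLIntegral_congr_fun hK fun y hy => ?_
    simp only [hFf θ x hx, hFf θ y hy]
  simp_rw [heq]
  unfold gagliardoSeminorm
  refine Measurable.pow_const ?_ _
  have h1 : Measurable fun q : (Θ × EuclideanSpace ℝ (Fin d)) × EuclideanSpace ℝ (Fin d) =>
      ‖F (q.1.2, q.1.1) - F (q.2, q.1.1)‖ₑ ^ p / edist q.1.2 q.2 ^ ((d : ℝ) + s * p) := by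
    refine Measurable.div (Measurable.pow_const (Measurable.enorm (Measurable.sub ?_ ?_)) _)
      (Measurable.pow_const (by fun_prop) _)
    · exact hFm.comp (by fun_prop)
    · exact hFm.comp (by fun_prop)
  have h2 : Measurable fun q : Θ × EuclideanSpace ℝ (Fin d) => ∫⁻ y in K,
      ‖F (q.2, q.1) - F (y, q.1)‖ₑ ^ p / edist q.2 y ^ ((d : ℝ) + s * p) :=
    h1.lintegral_prod_right'
  exact h2.lintegral_prod_right'

/-- The Hölder bound for almost every density. If `s < 1`, the seminorm is measurable in `θ`, hence
finite almost everywhere. If `s = 1`, no measurability is used: where the seminorm is infinite, the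
right-hand side is infinite because the best constant is positive. -/
theorem ae_edist_le (hd : 0 < d) (hs : 0 < s - d / p) (hK : IsOpen K) (hKX : K ⊆ X)
    (hC : sobolevConstant s p K < ∞) (hf : Measurable fun q : X × Θ => f q.1 q.2)
    (hfc : ∀ᵐ θ ∂π, ContinuousOn (fun x : X => f x θ)
      {x : X | (x : EuclideanSpace ℝ (Fin d)) ∈ K})
    (hB : sobolevAverage s p K π f < ∞) :
    ∀ᵐ θ ∂π, ∀ x y : X, (x : EuclideanSpace ℝ (Fin d)) ∈ K → (y : EuclideanSpace ℝ (Fin d)) ∈ K →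
      edist (f x θ) (f y θ) ≤ sobolevConstant s p K *
        sobolevSeminorm s p K (Function.extend Subtype.val (fun x : X => f x θ) 0) *
          edist x y ^ (s - d / p) := by
  set F : Θ → EuclideanSpace ℝ (Fin d) → ℝ :=
    fun θ => Function.extend Subtype.val (fun x : X => f x θ) 0 with hF
  have hFf : ∀ θ (x : X), F θ x = f x θ := fun θ x => extend_val_apply _ x.2
  have hfin : ∀ᵐ θ ∂π, sobolevSeminorm s p K (F θ) = ∞ → K.Nonempty →
      sobolevConstant s p K ≠ 0 := by
    by_cases hs1 : s = 1
    · subst hs1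
      exact ae_of_all _ fun θ _ hne => sobolevConstant_one_ne_zero hd hs hK hne
    · have hm : Measurable fun θ => sobolevSeminorm s p K (F θ) := by
        simp only [sobolevSeminorm, if_neg hs1]
        exact measurable_gagliardoSeminorm_extend hK.measurableSet hKX hf
      filter_upwards [ae_lt_top hm hB.ne] with θ hθ h
      exact absurd h hθ.ne
  filter_upwards [hfc, hfin] with θ hθc hθ x y hx hy
  rcases eq_or_ne x y with rfl | hxy
  · simp
  by_cases hS : sobolevSeminorm s p K (F θ) = ∞
  · have h0 : edist x y ^ (s - d / p) ≠ 0 := by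
      simp [ENNReal.rpow_eq_zero_iff, hxy, edist_ne_top]
    rw [hS, ENNReal.mul_top (hθ hS ⟨x, hx⟩), ENNReal.top_mul h0]
    exact le_top
  · have hFc : ContinuousOn (F θ) K := by
      rw [continuousOn_iff_continuous_domRestrict] at hθc ⊢
      have h1 : Continuous fun z : K => (⟨⟨z, hKX z.2⟩, z.2⟩ :
          {x : X | (x : EuclideanSpace ℝ (Fin d)) ∈ K}) := by fun_prop
      refine (hθc.comp h1).congr fun z => ?_
      exact (hFf θ ⟨z, hKX z.2⟩).symm
    rw [← hFf, ← hFf]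
    refine (edist_le_holderSeminorm_mul hs.le hx hy).trans ?_
    exact mul_le_mul_left (holderSeminorm_le_sobolevConstant_mul hs hK hC hFc hS) _

theorem lintegral_edist_le (hd : 0 < d) (hs : 0 < s - d / p) (hK : IsOpen K)
    (hKX : K ⊆ X) (hC : sobolevConstant s p K < ∞) (hf : Measurable fun q : X × Θ => f q.1 q.2)
    (hfc : ∀ᵐ θ ∂π, ContinuousOn (fun x : X => f x θ)
      {x : X | (x : EuclideanSpace ℝ (Fin d)) ∈ K})
    (hB : sobolevAverage s p K π f < ∞) {x y : X} (hx : (x : EuclideanSpace ℝ (Fin d)) ∈ K)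
    (hy : (y : EuclideanSpace ℝ (Fin d)) ∈ K) :
    ∫⁻ θ, edist (f x θ) (f y θ) ∂π ≤
      sobolevConstant s p K * sobolevAverage s p K π f * edist x y ^ (s - d / p) := by
  -- constants are moved into the integral of the seminorm, which may fail to be measurable in `θ`
  rw [sobolevAverage, ← lintegral_const_mul' _ _ hC.ne, ← lintegral_mul_const' _ _
    (ENNReal.rpow_ne_top_of_nonneg hs.le (edist_ne_top _ _))]
  refine lintegral_mono_ae ?_
  filter_upwards [ae_edist_le hd hs hK hKX hC hf hfc hB] with θ hθ
  exact hθ x y hx hy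

end FamilyOfDensities

theorem corollary2 {d : ℕ} (hd : 0 < d) (s p : ℝ) (hp : 1 ≤ p) (hs : (d : ℝ) / p < s) (hs1 : s ≤ 1)
    (K : Set (EuclideanSpace ℝ (Fin d))) (hK : IsOpen K) (hKL : HasLipschitzBoundary K) :
    -- the Sobolev constant of `K` is finite
    ((Bornology.IsBounded K ∨ K = Set.univ) → (s < 1 ∨ IsPreconnected K) → sobolevConstant s p K < ∞) ∧
    -- the estimate for the posterior
    (sobolevConstant s p K < ∞ →
      ∀ (X : Set (EuclideanSpace ℝ (Fin d))) (_ : K ⊆ X)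
        (Θ : Type*) [TopologicalSpace Θ] [PolishSpace Θ] [MeasurableSpace Θ] [BorelSpace Θ]
        (π : Measure Θ) [IsProbabilityMeasure π]
        (lam : Measure X) [SigmaFinite lam]
        (ν : Kernel Θ X) [IsMarkovKernel ν]
        (f : X → Θ → ℝ) (_ : Measurable (fun q : X × Θ => f q.1 q.2)) (_ : ∀ x θ, 0 ≤ f x θ)
        (_ : ∀ θ, ν θ = lam.withDensity (fun x => ENNReal.ofReal (f x θ)))
        (_ : ∀ᵐ θ ∂π, ContinuousOn (fun x : X => f x θ) {x : X | (x : EuclideanSpace ℝ (Fin d)) ∈ K})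
        (_ : ∃ x : X, (x : EuclideanSpace ℝ (Fin d)) ∈ K ∧ marginalDensity π f x < ∞)
        (_ : sobolevAverage s p K π f < ∞)
        (_ : 0 < infMarginal π f K),
        (∀ x : X, (x : EuclideanSpace ℝ (Fin d)) ∈ K → marginalDensity π f x < ∞) ∧
        ∀ x y : X, (x : EuclideanSpace ℝ (Fin d)) ∈ K → (y : EuclideanSpace ℝ (Fin d)) ∈ K →
          tvDistance (bayesPosterior π f x) (bayesPosterior π f y) ≤
            sobolevConstant s p K * sobolevAverage s p K π f / infMarginal π f K
              * edist x y ^ (s - d / p)) := by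
  have hs' : 0 < s - d / p := sub_pos.2 hs
  refine ⟨fun hKb hKc => sobolevConstant_lt_top hp hs hK hKL hKb hKc, ?_⟩
  intro hC X hKX Θ _ _ _ _ π _ lam _ ν _ f hf _ _ hfc hx₀ hB hR
  obtain ⟨x₀, hx₀K, hx₀⟩ := hx₀
  have hfm : ∀ x, Measurable (f x) := fun x => hf.comp measurable_prodMk_left
  have hΔ := fun {x y : X} hx hy =>
    lintegral_edist_le (x := x) (y := y) hd hs' hK hKX hC hf hfc hB hx hy
  have hfin : ∀ x : X, (x : EuclideanSpace ℝ (Fin d)) ∈ K → marginalDensity π f x < ∞ := by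
    intro x hx
    have h1 := setLIntegral_ofReal_le_add (π := π) hfm univ x x₀
    simp only [Measure.restrict_univ] at h1
    refine h1.trans_lt (ENNReal.add_lt_top.2 ⟨hx₀, (hΔ hx hx₀K).trans_lt ?_⟩)
    exact ENNReal.mul_lt_top (ENNReal.mul_lt_top hC hB)
      (ENNReal.rpow_ne_top_of_nonneg hs'.le (edist_ne_top _ _)).lt_top
  refine ⟨hfin, fun x y hx hy => ?_⟩
  have hRle : ∀ z : X, (z : EuclideanSpace ℝ (Fin d)) ∈ K →
      infMarginal π f K ≤ marginalDensity π f z := fun z hz => iInf₂_le z hz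
  refine (tvDistance_bayesPosterior_le hfm (hR.trans_le (hRle x hx)).ne' (hfin x hx).ne
    (hR.trans_le (hRle y hy)).ne' (hfin y hy).ne).trans ?_
  calc (∫⁻ θ, edist (f x θ) (f y θ) ∂π) / marginalDensity π f x
      ≤ (sobolevConstant s p K * sobolevAverage s p K π f * edist x y ^ (s - d / p)) /
          infMarginal π f K := ENNReal.div_le_div (hΔ hx hy) (hRle x hx)
    _ = _ := by simp only [div_eq_mul_inv]; ring
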